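/- **Setting.** Let $\mathcal M=(E,\mathcal I)$ be a matroid on a finite ground set $E$ that is partitioned into sets $E_1,\dots,E_n$, one per agent. An outcome of agent $i$ is a set $x_i\subseteq E_i$; a profile $\mathbf x=(x_1,\dots,x_n)$ is feasible if $\bigcup_i x_i\in\mathcal I$. Write $\mathbf v(\mathbf x)=\sum_i v_i(x_i)$, let $\mathsf{OPT}(\mathbf v)$ be a feasible profile of maximum welfare, and for a set $S$ let $\mathcal F_S$ be the set of profiles $\mathbf t$ such that $\bigcup_i t_i$ is disjoint from $S$ and $S\cup\bigcup_i t_i\in\mathcal I$; for $S\in\mathcal I$ let $\mathsf{OPT}(\mathbf v\mid S)$ be a profile in $\mathcal F_S$ of maximum welfare. For profiles put $\mathcal F_{\mathbf x}=\mathcal F_{\bigcup_i x_i}$. A valuation $v_i:2^{E_i}\to\mathbb R_{\ge0}$ is *additive* if $v_i(S)=\sum_{j\in S}w_j$ with $w_j\ge 0$, *XOS* if it is a maximum of finitely many additive valuations, and *submodular* if it is monotone, $v_i(\emptyset)=0$ and $v_i(S\cup T)+v_i(S\cap T)\le v_i(S)+v_i(T)$. An additive profile $\tilde{\mathbf v}$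 *supports* $\mathbf v$ at $\mathbf z$ if $\tilde v_i\le v_i$ and $\tilde v_i(z_i)=v_i(z_i)$ for all $i$. A *(dynamic) pricing rule* assigns to an agent $i$, an outcome $x_i$ and a partial allocation $\mathbf y$ a price $p_i(x_i\mid\mathbf y)\in[0,\infty]$, with price $\infty$ if $(x_i,\mathbf y_{-i})$ is infeasible and $p_i(\emptyset\mid\mathbf y)=0$ if $\mathbf y$ is feasible. For an order of the agents let $\mathbf x_{<i}$ be $\mathbf x$ with the outcomes of $i$ and of all later agents replaced by $\emptyset$. For a profile $\mathbf v$, an allocation rule $\mathsf{ALG}$ and a given order, $p$ is *$(1,1)$-balanced* with respect to $(\mathcal F_{\mathbf x})$ if this family is exchange compatible (i.e. $(y_i,\mathbf x_{-i})$ is feasible for all $\mathbf x$, all $\mathbf y\in\mathcal F_{\mathbf x}$ and all $i$) and for all feasible $\mathbf x$ $$\sum_i p_i(x_i\mid\mathbf x_{<i})\ \ge\ \mathbf v(\mathsf{ALG}(\mathbf v))-\max_{\mathbf t\in\mathcal F_{\mathbf x}}\mathbf v(\mathbf t),\qquad \sum_i p_i(x_i'\mid\mathbf x_{<i})\ \le\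 \max_{\mathbf t\in\mathcal F_{\mathbf x}}\mathbf v(\mathbf t)\quad\text{for all }\mathbf x'\in\mathcal F_{\mathbf x}.$$ In the *posted-price mechanism* the agents arrive in some order, and each buys a utility-maximizing outcome at the prices given the allocation so far. Ties are broken arbitrarily, but measurably and without knowledge of the valuations of later agents. $\mathsf{GRD}(\mathbf v)$ is the output of the greedy algorithm: starting from $\emptyset$, add an element that increases the welfare the most among the elements whose addition keeps independence, until no element can be added (ties broken arbitrarily). For an additive profile $\mathbf u$ define $$p_i^{\mathbf u}(x_i\mid\mathbf y)=\mathbf u\big(\mathsf{OPT}(\mathbf u\mid\textstyle\bigcup_j y_j)\big)-\mathbf u\big(\mathsf{OPT}(\mathbf u\mid\textstyle\bigcup_j y_j\cup x_i)\big)\ \text{ if }\textstyle\bigcup_j y_j\cup x_i\in\mathcal I,\qquad p_i^{\mathbf u}(x_i\mid\mathbf y)=\infty\ \text{ otherwise.}$$ **Theorem.** 1. If $\mathbf v$ is additive, then $p^{\mathbf v}$ is $(1,1)$-balanced for $\mathbf v$ with respect to $\mathsf{OPT}$ and $(\mathcal F_{\mathbf x})$, for every order of the agents. 2. If every $v_i$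 is additive, submodular or XOS, then there is an additive profile that supports $\mathbf v$ at $\mathsf{OPT}(\mathbf v)$, and for each such profile $\tilde{\mathbf v}$ the prices $p^{\tilde{\mathbf v}}$ are $(1,1)$-balanced for $\mathbf v$ with respect to $\mathsf{OPT}$ and $(\mathcal F_{\mathbf x})$, for every order. 3. If $\mathbf v\sim\mathcal D=\mathcal D_1\times\dots\times\mathcal D_n$ where $\mathcal D_i$ is supported on additive, submodular or XOS valuations with values in $[0,1]$, then there is a pricing rule whose posted-price mechanism has expected welfare at least $\frac12\,\mathbf E[\mathbf v(\mathsf{OPT}(\mathbf v))]$ for every order of the agents. 4. Part 2 holds with $\mathsf{GRD}$ in place of $\mathsf{OPT}$ throughout. 5. There is a fixed polynomial $P$ such that for all $n$, $\mathcal M$, $E_1,\dots,E_n$, all $\varepsilon>0$ and $\delta\in(0,1)$ there is an algorithm with the following property. It is given $N\le P$ samples and makes at most $P$ value queries to the sampled valuations, where $P=P(n,|E|,1/\varepsilon,\log(1/\delta))$, and outputs the pricing rule $\frac12\cdot\frac1N\sum_{t=1}^N p^{\tilde{\mathbf v}^{(t)}}$, where the weights of $\tilde{\mathbf v}^{(t)}$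 depend on the $t$-th sample $\mathbf v^{(t)}$ only and, if $\mathbf v^{(t)}$ is a submodular profile, $\tilde{\mathbf v}^{(t)}$ is an additive profile that supports $\mathbf v^{(t)}$ at a greedy output for $\mathbf v^{(t)}$. For every product distribution $\mathcal D$ on submodular profiles with values in $[0,1]$, with probability at least $1-\delta$ over $N$ independent samples from $\mathcal D$, the posted-price mechanism with these prices has expected welfare at least $\frac14\,\mathbf E[\mathbf v(\mathsf{OPT}(\mathbf v))]-\varepsilon$ for every order of the agents. -/

import Mathlib

open MeasureTheory
open scoped ENNReal

universe u

namespace MatroidPricing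

section Model

variable {n : ℕ}

/-- An outcome profile. Agent `i` owns the elements of `E i`, her outcomes are the subsets of `E i`,
and the ground set of the matroid is the disjoint union `Σ i, E i`. The null outcome is `∅`. -/
abbrev Alloc (E : Fin n → Type u) : Type u := ∀ i, Finset (E i)

/-- A valuation profile: one function from bundles to the reals for every agent. -/
abbrev Profile (E : Fin n → Type u) : Type u := ∀ i, Finset (E i) → ℝ

/-- Element weights, the data of an additive valuation profile. -/
abbrev Weights (E : Fin n → Type u) : Type u := ∀ i, E i → ℝ

variable {E : Fin n → Type u}

/-- The set of all elements that are allocated in `x`. -/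
def allocated (x : Alloc E) : Finset (Σ i, E i) := Finset.univ.sigma x

/-- The outcome `S` of agent `i` as a subset of the ground set. -/
def bundle (i : Fin n) (S : Finset (E i)) : Finset (Σ i, E i) :=
  S.map (Function.Embedding.sigmaMk i)

/-- An allocation is feasible if the chosen elements form an independent set. -/
def Feasible (M : Matroid (Σ i, E i)) (x : Alloc E) : Prop :=
  M.Indep (allocated x : Set (Σ i, E i))

/-- The welfare of an outcome profile. -/
def welfare (v : Profile E) (x : Alloc E) : ℝ := ∑ i, v i (x i)

/-- The optimal welfare over a set `H` of outcome profiles. It is only used for nonempty `H`;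
there are finitely many outcome profiles, so the supremum is then a maximum. -/
noncomputable def optWelfare (v : Profile E) (H : Set (Alloc E)) : ℝ := sSup (welfare v '' H)

/-- `OPT` is a welfare-maximizing outcome rule. -/
def IsOptimalRule (M : Matroid (Σ i, E i)) (OPT : Profile E → Alloc E) : Prop :=
  ∀ v, Feasible M (OPT v) ∧ ∀ y, Feasible M y → welfare v y ≤ welfare v (OPT v)

/-- The additive valuation profile with the given element weights. -/
def additiveProfile (w : Weights E) : Profile E := fun i S => ∑ j ∈ S, w i j

/-- The additive profile with nonnegative weights `a` supports the profile `v` at `z`. -/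
structure Supports (a : Weights E) (v : Profile E) (z : Alloc E) : Prop where
  nonneg : ∀ i j, 0 ≤ a i j
  le : ∀ i S, additiveProfile a i S ≤ v i S
  eq : ∀ i, additiveProfile a i (z i) = v i (z i)

end Model

section Valuations

variable {α : Type u}

def IsAdditive (v : Finset α → ℝ) : Prop :=
  ∃ w : α → ℝ, (∀ j, 0 ≤ w j) ∧ ∀ S, v S = ∑ j ∈ S, w j

/-- Submodular valuations are, as usual for valuations, normalized and monotone. -/
structure IsSubmodular [DecidableEq α] (v : Finset α → ℝ) : Prop where
  empty : v ∅ = 0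
  mono : Monotone v
  submod : ∀ S T, v (S ∪ T) + v (S ∩ T) ≤ v S + v T

/-- A pointwise maximum of finitely many (and at least one) additive valuations. -/
def IsXOS (v : Finset α → ℝ) : Prop :=
  ∃ A : Set (α → ℝ), A.Finite ∧ (∀ a ∈ A, ∀ j, 0 ≤ a j) ∧
    ∀ S, IsGreatest ((fun a : α → ℝ => ∑ j ∈ S, a j) '' A) (v S)

end Valuations

section Pricing

variable {n : ℕ} {E : Fin n → Type u} [∀ i, DecidableEq (E i)]

/-- The allocations that remain feasible when the elements of `S` have been allocated, that is,
the independent sets of the contraction of the matroid by `S`. -/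
def residual (M : Matroid (Σ i, E i)) (S : Finset (Σ i, E i)) : Set (Alloc E) :=
  {t | Disjoint S (allocated t) ∧ M.Indep ((S ∪ allocated t : Finset _) : Set (Σ i, E i))}

/-- `v(OPT(v | S))`, the optimal residual welfare. -/
noncomputable def residualOpt (M : Matroid (Σ i, E i)) (v : Profile E)
    (S : Finset (Σ i, E i)) : ℝ := optWelfare v (residual M S)

/-- The residual welfare does not increase when more elements are allocated. Hence the differences
that are used as prices below are nonnegative. -/
theorem residualOpt_anti [∀ i, Fintype (E i)] (M : Matroid (Σ i, E i)) (v : Profile E)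
    {S T : Finset (Σ i, E i)} (hST : S ⊆ T)
    (hT : M.Indep (T : Set (Σ i, E i))) : residualOpt M v T ≤ residualOpt M v S := by
  unfold residualOpt optWelfare
  refine csSup_le_csSup (Set.toFinite _).bddAbove ?_ ?_
  · refine ⟨_, fun _ => ∅, ⟨?_, ?_⟩, rfl⟩
    · simp [allocated, Finset.disjoint_left]
    · have : allocated (fun i => (∅ : Finset (E i))) = ∅ := by ext; simp [allocated]
      simpa [this] using hT
  · refine Set.image_mono ?_
    rintro t ⟨h1, h2⟩
    exact ⟨h1.mono_left hST, h2.subset (by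
      exact_mod_cast Finset.union_subset_union_left hST)⟩

/-- A pricing rule: `price i S y` is the price of outcome `S` for agent `i`, given the partial
allocation `y`. Outcomes that are infeasible together with `y` cost `∞`, and the null outcome
is free. -/
structure PricingRule (M : Matroid (Σ i, E i)) where
  price : ∀ i : Fin n, Finset (E i) → Alloc E → ℝ≥0∞
  infeasible : ∀ i S y, ¬ Feasible M (Function.update y i S) → price i S y = ⊤
  null : ∀ i y, Feasible M y → price i ∅ y = 0

open Classical in
/-- The prices `v(OPT(v | ⋃ y)) - v(OPT(v | ⋃ y ∪ S))`. -/
noncomputable def matroidPricing (M : Matroid (Σ i, E i)) (v : Profile E) : PricingRule M where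
  price i S y :=
    if M.Indep ((allocated y ∪ bundle i S : Finset _) : Set (Σ i, E i)) then
      ENNReal.ofReal (residualOpt M v (allocated y) - residualOpt M v (allocated y ∪ bundle i S))
    else ⊤
  infeasible i S y h := by
    refine if_neg fun hI => h (hI.subset ?_)
    rintro ⟨j, e⟩ he
    by_cases hj : j = i
    · subst hj
      simp only [allocated, Finset.coe_sigma, Set.mem_sigma_iff, Finset.mem_coe,
        Function.update_self] at he
      simp [bundle, he.2]
    · simp only [allocated, Finset.coe_sigma, Set.mem_sigma_iff, Finset.mem_coe,
        Function.update_of_ne hj] at he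
      simp [allocated, he.2]
  null i y h := by
    have h' : bundle i (∅ : Finset (E i)) = ∅ := by simp [bundle]
    simp only [h', Finset.union_empty, sub_self, ENNReal.ofReal_zero]
    exact if_pos h

/-- The part of `x` that has been allocated before agent `i` is approached. The agents are
approached in the order `σ 0, σ 1, …`. -/
def before (σ : Equiv.Perm (Fin n)) (x : Alloc E) (i : Fin n) : Alloc E :=
  fun j => if σ.symm j < σ.symm i then x j else ∅

/-- The family `H` is exchange compatible with the feasible allocations. -/
def ExchangeCompatible (M : Matroid (Σ i, E i)) (H : Alloc E → Set (Alloc E)) : Prop :=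
  ∀ x, ∀ y ∈ H x, ∀ i, Feasible M (Function.update x i (y i))

/-- `(α, β)`-balancedness of `p` for the valuation profile `v`, with respect to the allocation
rule `ALG`, the exchange compatible family `H` and the indexing `σ` of the agents. -/
structure IsBalanced (M : Matroid (Σ i, E i)) (v : Profile E) (p : PricingRule M) (α β : ℝ)
    (ALG : Profile E → Alloc E) (H : Alloc E → Set (Alloc E)) (σ : Equiv.Perm (Fin n)) :
    Prop where
  compatible : ExchangeCompatible M H
  lower : ∀ x, Feasible M x →
    ENNReal.ofReal (1 / α * (welfare v (ALG v) - optWelfare v (H x))) ≤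
      ∑ i, p.price i (x i) (before σ x i)
  upper : ∀ x, Feasible M x → ∀ x' ∈ H x,
    ∑ i, p.price i (x' i) (before σ x i) ≤ ENNReal.ofReal (β * optWelfare v (H x))

/-- The utility of agent `i` with valuation `v` for outcome `S`, given the partial allocation. -/
noncomputable def utility {M : Matroid (Σ i, E i)} (p : PricingRule M) (i : Fin n)
    (v : Finset (E i) → ℝ) (y : Alloc E) (S : Finset (E i)) : EReal :=
  (v S : EReal) - (p.price i S y : EReal)

/-- `X v` is the outcome of the posted-price mechanism with pricing rule `p` and order `σ` when the
valuations are `v`: every agent buys an outcome of maximum utility. Ties are broken arbitrarily,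
but measurably and without knowledge of the valuations of later agents. -/
structure IsOutcomeMap {M : Matroid (Σ i, E i)} (p : PricingRule M) (σ : Equiv.Perm (Fin n))
    (X : Profile E → Alloc E) : Prop where
  maximizes : ∀ v i S,
    utility p i (v i) (before σ (X v) i) S ≤ utility p i (v i) (before σ (X v) i) (X v i)
  online : ∀ v v' i, (∀ j, σ.symm j ≤ σ.symm i → v j = v' j) → X v i = X v' i
  measurable : ∀ z, MeasurableSet {v | X v = z}

/-- One step of the greedy algorithm: add an element that increases the welfare the most among all
elements that can be added. -/
def GreedyStep (M : Matroid (Σ i, E i)) (v : Profile E) (x x' : Alloc E) : Prop :=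
  ∃ i, ∃ e ∉ x i, x' = Function.update x i (insert e (x i)) ∧ Feasible M x' ∧
    ∀ j, ∀ f ∉ x j, Feasible M (Function.update x j (insert f (x j))) →
      welfare v (Function.update x j (insert f (x j))) ≤ welfare v x'

/-- `g` is an output of the greedy algorithm (under some tie breaking): it is reached from the empty
allocation by greedy steps and no further element can be added. -/
def IsGreedyOutput (M : Matroid (Σ i, E i)) (v : Profile E) (g : Alloc E) : Prop :=
  Relation.ReflTransGen (GreedyStep M v) (fun _ => ∅) g ∧ ∀ x, ¬ GreedyStep M v g x

end Pricing

section Queries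

variable {n : ℕ}

/-- A (deterministic, adaptive) algorithm that accesses `N` sampled valuation profiles by value
queries only: `query t i S next` asks for the value of `S` for agent `i` in sample `t` and goes on
with the answer. -/
inductive ValueQueryAlg (N : ℕ) (E : Fin n → Type u) (β : Type u) : Type u
  | done (b : β) : ValueQueryAlg N E β
  | query (t : Fin N) (i : Fin n) (S : Finset (E i)) (next : ℝ → ValueQueryAlg N E β) :
      ValueQueryAlg N E β

variable {N : ℕ} {E : Fin n → Type u} {β : Type u}

/-- The output on the samples `w`. -/
def ValueQueryAlg.run (w : Fin N → Profile E) : ValueQueryAlg N E β → β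
  | .done b => b
  | .query t i S next => (next (w t i S)).run w

/-- The number of value queries that are made on the samples `w`. -/
def ValueQueryAlg.numQueries (w : Fin N → Profile E) : ValueQueryAlg N E β → ℕ
  | .done _ => 0
  | .query t i S next => (next (w t i S)).numQueries w + 1

end Queries

end MatroidPricing

namespace MatroidPricing

set_option linter.unusedSectionVars false

/-! ### Symmetric exchange in matroids -/

section Exchange

variable {α : Type*} {M : Matroid α}

/-- A strengthening of symmetric basis exchange for independent sets: if `b ∈ K` cannot be added to
`I`, then it can be swapped for some element of `I` in both `I` and `K`. -/
theorem exists_symm_exchange {I K : Set α} (hI : M.Indep I) (hK : M.Indep K) {b : α} (hbK : b ∈ K)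
    (hbI : ¬ M.Indep (insert b I)) :
    ∃ c ∈ I, c ∉ K ∧ M.Indep (insert b (I \ {c})) ∧ M.Indep (insert c (K \ {b})) := by
  have hbE : b ∈ M.E := hK.subset_ground hbK
  have hbI' : b ∉ I := fun h => hbI (by rwa [Set.insert_eq_of_mem h])
  have hcl : b ∈ M.closure I := by
    by_contra h
    exact hbI ((hI.notMem_closure_iff_of_notMem hbI' hbE).1 h)
  have hC := hI.fundCircuit_isCircuit hcl hbI'
  -- Let `C` be the fundamental circuit of `b` in `I`. If `C \ {b}` lay in the closure of `K \ {b}`,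
  -- so would `b`, against independence of `K`. Any `c ∈ C \ {b}` outside that closure can be
  -- swapped on both sides.
  have hbC : b ∈ M.closure (M.fundCircuit b I \ {b}) :=
    hC.mem_closure_sdiff_singleton_of_mem (M.mem_fundCircuit b I)
  have hKb : M.Indep (K \ {b}) := hK.subset Set.sdiff_subset
  obtain ⟨c, hcC, hc⟩ : ∃ c ∈ M.fundCircuit b I \ {b}, c ∉ M.closure (K \ {b}) := by
    by_contra! h
    exact hK.notMem_closure_sdiff_of_mem hbK (M.closure_subset_closure_of_subset_closure h hbC)
  have hcE : c ∈ M.E := hC.subset_ground hcC.1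
  have hcK' : c ∉ K \ {b} := fun h => hc (M.mem_closure_of_mem' h hcE)
  have hcb : c ≠ b := hcC.2
  refine ⟨c, ?_, fun h => hcK' ⟨h, hcb⟩, ?_, (hKb.notMem_closure_iff_of_notMem hcK' hcE).1 hc⟩
  · exact (Set.mem_insert_iff.1 (M.fundCircuit_subset_insert b I hcC.1)).resolve_left hcb
  · have := (hI.mem_fundCircuit_iff hcl hbI').1 hcC.1
    rwa [Set.insert_sdiff_of_notMem _ (by simpa using hcb.symm)] at this

end Exchange

/-! ### Allocations as subsets of the ground set -/

section Allocations

variable {n : ℕ} {E : Fin n → Type u}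

@[simp] theorem mem_allocated {x : Alloc E} {e : Σ i, E i} : e ∈ allocated x ↔ e.2 ∈ x e.1 := by
  simp [allocated]

theorem welfare_additiveProfile (a : Weights E) (x : Alloc E) :
    welfare (additiveProfile a) x = ∑ e ∈ allocated x, a e.1 e.2 := by
  simp [welfare, additiveProfile, allocated, Finset.sum_sigma]

variable [∀ i, DecidableEq (E i)]

@[simp] theorem mem_bundle {i : Fin n} {S : Finset (E i)} {e : Σ i, E i} :
    e ∈ bundle i S ↔ ∃ s ∈ S, ⟨i, s⟩ = e := by
  simp [bundle]

theorem allocated_update_insert (x : Alloc E) (i : Fin n) (e : E i) :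
    allocated (Function.update x i (insert e (x i))) = insert ⟨i, e⟩ (allocated x) := by
  ext ⟨j, f⟩
  by_cases h : j = i
  · subst h; simp
  · simp [h]

variable [∀ i, Fintype (E i)]

/-- The profile in which every agent receives her elements of `S`. -/
def allocOf (S : Finset (Σ i, E i)) : Alloc E := fun i => {e | (⟨i, e⟩ : Σ i, E i) ∈ S}

@[simp] theorem mem_allocOf {S : Finset (Σ i, E i)} {i : Fin n} {e : E i} :
    e ∈ allocOf S i ↔ (⟨i, e⟩ : Σ i, E i) ∈ S := by simp [allocOf]

@[simp] theorem allocated_allocOf (S : Finset (Σ i, E i)) : allocated (allocOf S) = S := by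
  ext e; simp

@[simp] theorem allocOf_allocated (x : Alloc E) : allocOf (allocated x) = x := by
  ext i e; simp

end Allocations

/-! ### Residual optima and their submodularity -/

section Residual

variable {n : ℕ} {E : Fin n → Type u} [∀ i, DecidableEq (E i)] [∀ i, Fintype (E i)]
  {M : Matroid (Σ i, E i)} {S T : Finset (Σ i, E i)}

theorem allocated_empty : allocated (fun i => (∅ : Finset (E i))) = ∅ := by ext; simp

theorem empty_mem_residual (hS : M.Indep (S : Set (Σ i, E i))) :
    (fun _ => ∅ : Alloc E) ∈ residual M S := by
  refine ⟨?_, ?_⟩ <;> simp only [allocated_empty]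
  · simp
  · simpa using hS

theorem residual_empty : residual M (∅ : Finset (Σ i, E i)) = {x | Feasible M x} := by
  ext x; simp [residual, Feasible]

theorem feasible_empty : Feasible M (fun _ => ∅ : Alloc E) := by
  simp [Feasible, allocated_empty]

theorem welfare_le_residualOpt (v : Profile E) {t : Alloc E} (ht : t ∈ residual M S) :
    welfare v t ≤ residualOpt M v S :=
  le_csSup (Set.toFinite _).bddAbove ⟨t, ht, rfl⟩

theorem exists_welfare_eq_residualOpt (v : Profile E) (hS : M.Indep (S : Set (Σ i, E i))) :
    ∃ t ∈ residual M S, welfare v t = residualOpt M v S :=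
  Set.Nonempty.csSup_mem (s := welfare v '' residual M S)
    ⟨_, _, empty_mem_residual hS, rfl⟩ (Set.toFinite _)

/-- The supremum is then over the empty set, where `sSup` takes the default value 0. This makes
monotonicity and measurability hold for every `S`. -/
theorem residualOpt_of_not_indep (v : Profile E) (hS : ¬ M.Indep (S : Set (Σ i, E i))) :
    residualOpt M v S = 0 := by
  have : residual M S = ∅ := by
    ext t
    simp only [residual, Set.mem_ofPred_eq, Set.mem_empty_iff_false, iff_false, not_and]
    exact fun _ h => hS (h.subset (by simp))
  simp [residualOpt, optWelfare, this]

theorem residualOpt_mono {v v' : Profile E} (h : ∀ i S, v i S ≤ v' i S)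
    (S : Finset (Σ i, E i)) : residualOpt M v S ≤ residualOpt M v' S := by
  by_cases hS : M.Indep (S : Set (Σ i, E i))
  · obtain ⟨t, ht, h'⟩ := exists_welfare_eq_residualOpt v hS
    rw [← h']
    exact (Finset.sum_le_sum fun i _ => h i _).trans (welfare_le_residualOpt v' ht)
  · simp [residualOpt_of_not_indep _ hS]

theorem residualOpt_nonneg {v : Profile E} (h : ∀ i S, 0 ≤ v i S) (S : Finset (Σ i, E i)) :
    0 ≤ residualOpt M v S :=
  Real.sSup_nonneg (by rintro _ ⟨t, _, rfl⟩; exact Finset.sum_nonneg fun i _ => h i _)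

theorem residualOpt_le {v : Profile E} (h : ∀ i S, v i S ≤ 1) (S : Finset (Σ i, E i)) :
    residualOpt M v S ≤ n := by
  refine Real.sSup_le ?_ n.cast_nonneg
  rintro _ ⟨t, _, rfl⟩
  exact (Finset.sum_le_sum fun i _ => h i (t i)).trans (by simp)

variable {a : Weights E}

theorem sum_le_residualOpt {J : Finset (Σ i, E i)} (hd : Disjoint S J)
    (h : M.Indep ((S ∪ J : Finset _) : Set (Σ i, E i))) :
    ∑ e ∈ J, a e.1 e.2 ≤ residualOpt M (additiveProfile a) S := by
  have := welfare_le_residualOpt (M := M) (S := S) (additiveProfile a) (t := allocOf J)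
    (by simpa [residual] using ⟨hd, by simpa using h⟩)
  simpa [welfare_additiveProfile] using this

theorem exists_sum_eq_residualOpt (a : Weights E) (hS : M.Indep (S : Set (Σ i, E i))) :
    ∃ J, Disjoint S J ∧ M.Indep ((S ∪ J : Finset _) : Set (Σ i, E i)) ∧
      ∑ e ∈ J, a e.1 e.2 = residualOpt M (additiveProfile a) S := by
  obtain ⟨t, ht, h⟩ := exists_welfare_eq_residualOpt (additiveProfile a) hS
  exact ⟨allocated t, ht.1, ht.2, by rw [← h, welfare_additiveProfile]⟩

/-- Take optimal completions `I` of `S` and `J` of `insert b S ∪ T` and redistribute them, with the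
same total weight, into completions of `insert b S` and of `S ∪ T`. If `b ∈ I`, then `b` moves to
`J`. If `b` can be added to `S ∪ I`, nothing moves. Otherwise symmetric exchange yields a `c ∈ I`
that moves to `J` and makes room for `b`. -/
theorem residualOpt_insert_add_le {b : Σ i, E i} (hbT : b ∉ T) (hbS : b ∉ S)
    (h : M.Indep ((insert b S ∪ T : Finset _) : Set (Σ i, E i))) :
    residualOpt M (additiveProfile a) S + residualOpt M (additiveProfile a) (insert b S ∪ T) ≤
      residualOpt M (additiveProfile a) (insert b S) +
        residualOpt M (additiveProfile a) (S ∪ T) := by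
  obtain ⟨I, hI, hSI, hIw⟩ := exists_sum_eq_residualOpt (M := M) (S := S) a
    (h.subset (by intro e; simp; tauto))
  obtain ⟨J, hJ, hSJ, hJw⟩ := exists_sum_eq_residualOpt a h
  rw [← hIw, ← hJw]
  have key : ∃ I' J', Disjoint (insert b S) I' ∧ Disjoint (S ∪ T) J' ∧
      M.Indep ((insert b S ∪ I' : Finset _) : Set (Σ i, E i)) ∧
      M.Indep ((S ∪ T ∪ J' : Finset _) : Set (Σ i, E i)) ∧
      ∑ e ∈ I, a e.1 e.2 + ∑ e ∈ J, a e.1 e.2 = ∑ e ∈ I', a e.1 e.2 + ∑ e ∈ J', a e.1 e.2 := by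
    rw [Finset.disjoint_left] at hI hJ
    by_cases hbI : b ∈ I
    · have hbJ : b ∉ J := hJ (by simp)
      refine ⟨I.erase b, insert b J, ?_, ?_, hSI.subset ?_, hSJ.subset ?_, ?_⟩
      · rw [Finset.disjoint_left]; intro e; have := @hI e; simp at this ⊢; grind
      · rw [Finset.disjoint_left]; intro e; have := @hJ e; simp at this ⊢; grind
      · intro e; simp; grind
      · intro e; simp
      · rw [Finset.sum_insert hbJ, ← Finset.add_sum_erase _ _ hbI]; ring
    · by_cases hin : M.Indep (insert b ((S ∪ I : Finset _) : Set (Σ i, E i)))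
      · refine ⟨I, J, ?_, ?_, hin.subset ?_, hSJ.subset ?_, rfl⟩
        · rw [Finset.disjoint_left]; intro e; have := @hI e; simp at this ⊢; grind
        · rw [Finset.disjoint_left]; intro e; have := @hJ e; simp at this ⊢; grind
        · intro e; simp
        · intro e; simp; tauto
      · obtain ⟨c, hcI, hcK, h1, h2⟩ := exists_symm_exchange hSI hSJ (b := b) (by simp) hin
        simp only [Finset.coe_union, Finset.coe_insert, Set.mem_union, Finset.mem_coe,
          Set.mem_insert_iff, not_or] at hcI hcK
        have hcI' : c ∈ I := hcI.resolve_left hcK.1.1.2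
        refine ⟨I.erase c, insert c J, ?_, ?_, h1.subset ?_, h2.subset ?_, ?_⟩
        · rw [Finset.disjoint_left]; intro e; have := @hI e; simp at this ⊢; grind
        · rw [Finset.disjoint_left]; intro e; have := @hJ e; simp at this ⊢; grind
        · intro e; simp; grind
        · intro e
          have := @hJ e
          simp at this ⊢; grind
        · rw [Finset.sum_insert hcK.2, ← Finset.add_sum_erase _ _ hcI']; ring
  obtain ⟨I', J', h1, h2, h3, h4, h5⟩ := key
  rw [h5]
  exact add_le_add (sum_le_residualOpt h1 h3) (sum_le_residualOpt h2 h4)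

/-- The residual optimum of an additive profile is a submodular function of the allocated set: the
loss that is caused by allocating `T` grows with the set that has already been allocated. -/
theorem residualOpt_sub_le_of_subset {A B T : Finset (Σ i, E i)} (hAB : A ⊆ B)
    (hBT : Disjoint B T) (h : M.Indep ((B ∪ T : Finset _) : Set (Σ i, E i))) :
    residualOpt M (additiveProfile a) A - residualOpt M (additiveProfile a) (A ∪ T) ≤
      residualOpt M (additiveProfile a) B - residualOpt M (additiveProfile a) (B ∪ T) := by
  -- The elements of `C` are added to `A` one at a time. `C` may overlap `A`, and an element that is
  -- already present changes nothing.
  obtain ⟨C, rfl⟩ : ∃ C, B = C ∪ A := ⟨B, by simpa using hAB⟩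
  clear hAB
  induction C using Finset.induction_on with
  | empty => simp
  | insert b C hb ih =>
    rw [Finset.insert_union] at *
    have ih := ih (hBT.mono_left (Finset.subset_insert _ _))
      (h.subset (by intro e; simp; tauto))
    by_cases hbA : b ∈ C ∪ A
    · rwa [Finset.insert_eq_of_mem hbA]
    · have := residualOpt_insert_add_le (a := a) (Finset.disjoint_left.1 hBT (by simp)) hbA h
      linarith

end Residual

/-! ### Balancedness of the prices -/

section Balanced

variable {n : ℕ} {E : Fin n → Type u} [∀ i, DecidableEq (E i)] [∀ i, Fintype (E i)]
  {M : Matroid (Σ i, E i)}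

/-- The elements that `x` gives to the first `k` agents of the order `σ`. -/
def allocatedFirst (σ : Equiv.Perm (Fin n)) (x : Alloc E) (k : ℕ) : Finset (Σ i, E i) :=
  {e | (σ.symm e.1 : ℕ) < k ∧ e.2 ∈ x e.1}

@[simp] theorem mem_allocatedFirst {σ : Equiv.Perm (Fin n)} {x : Alloc E} {k : ℕ}
    {e : Σ i, E i} : e ∈ allocatedFirst σ x k ↔ (σ.symm e.1 : ℕ) < k ∧ e.2 ∈ x e.1 := by
  simp [allocatedFirst]

theorem allocatedFirst_zero (σ : Equiv.Perm (Fin n)) (x : Alloc E) :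
    allocatedFirst σ x 0 = ∅ := by ext; simp

theorem allocatedFirst_top (σ : Equiv.Perm (Fin n)) (x : Alloc E) :
    allocatedFirst σ x n = allocated x := by ext; simp

theorem allocatedFirst_subset (σ : Equiv.Perm (Fin n)) (x : Alloc E) (k : ℕ) :
    allocatedFirst σ x k ⊆ allocated x := by intro e; simp

theorem allocatedFirst_mono (σ : Equiv.Perm (Fin n)) (x : Alloc E) :
    Monotone (allocatedFirst σ x) := by
  intro k l h e
  simp only [mem_allocatedFirst]
  exact fun h' => ⟨h'.1.trans_le h, h'.2⟩

theorem allocated_before (σ : Equiv.Perm (Fin n)) (x : Alloc E) (k : Fin n) :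
    allocated (before σ x (σ k)) = allocatedFirst σ x k := by
  ext ⟨j, e⟩
  simp only [mem_allocated, before, mem_allocatedFirst, σ.symm_apply_apply, Fin.lt_def]
  split_ifs with h <;> simp [h]

theorem allocatedFirst_union_bundle (σ : Equiv.Perm (Fin n)) (x : Alloc E) (k : Fin n) :
    allocatedFirst σ x k ∪ bundle (σ k) (x (σ k)) = allocatedFirst σ x (k + 1) := by
  ext ⟨j, e⟩
  obtain ⟨m, rfl⟩ := σ.surjective j
  simp only [Finset.mem_union, mem_allocatedFirst, σ.symm_apply_apply, mem_bundle, Sigma.mk.injEq,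
    EmbeddingLike.apply_eq_iff_eq, Order.lt_add_one_iff]
  constructor
  · rintro (h | ⟨s, hs, rfl, h⟩)
    · exact ⟨h.1.le, h.2⟩
    · cases h; exact ⟨le_rfl, hs⟩
  · rintro ⟨h, he⟩
    rcases h.lt_or_eq with h | h
    · exact .inl ⟨h, he⟩
    · obtain rfl := Fin.ext h
      exact .inr ⟨e, he, rfl, HEq.rfl⟩

theorem sum_sub_allocatedFirst (σ : Equiv.Perm (Fin n)) (x : Alloc E)
    (f : Finset (Σ i, E i) → ℝ) :
    ∑ k : Fin n, (f (allocatedFirst σ x k) - f (allocatedFirst σ x (k + 1))) =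
      f ∅ - f (allocated x) := by
  rw [Fin.sum_univ_eq_sum_range
    (fun k => f (allocatedFirst σ x k) - f (allocatedFirst σ x (k + 1))), Finset.sum_range_sub',
    allocatedFirst_zero, allocatedFirst_top]

theorem matroidPricing_price_of_indep (v : Profile E) {i : Fin n} {S : Finset (E i)} {y : Alloc E}
    (h : M.Indep ((allocated y ∪ bundle i S : Finset _) : Set (Σ i, E i))) :
    (matroidPricing M v).price i S y =
      ENNReal.ofReal (residualOpt M v (allocated y) - residualOpt M v (allocated y ∪ bundle i S)) :=
  if_pos h

/-- The agent at position `k` pays the drop of the residual optimum between the first `k` and the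
first `k + 1` agents, so the sum telescopes. -/
theorem sum_price_eq (v : Profile E) (σ : Equiv.Perm (Fin n)) {x : Alloc E} (hx : Feasible M x) :
    ∑ i, (matroidPricing M v).price i (x i) (before σ x i) =
      ENNReal.ofReal (residualOpt M v ∅ - residualOpt M v (allocated x)) := by
  have hind : ∀ k, M.Indep (allocatedFirst σ x k : Set (Σ i, E i)) := fun k =>
    hx.subset (by exact_mod_cast allocatedFirst_subset σ x k)
  rw [← Equiv.sum_comp σ, ← sum_sub_allocatedFirst σ x,
    ENNReal.ofReal_sum_of_nonneg fun k _ => sub_nonneg.2 (residualOpt_anti M v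
      (allocatedFirst_mono σ x (Nat.le_succ _)) (hind _))]
  refine Finset.sum_congr rfl fun k _ => ?_
  rw [matroidPricing_price_of_indep] <;>
    rw [allocated_before, allocatedFirst_union_bundle]
  exact hind _

/-- By submodularity, agent `σ k` pays at most the loss that her bundle of `x'` causes once all of
`x` and the bundles of earlier agents in `x'` are allocated. These losses telescope to `R (allocated
x) - R (allocated x ∪ allocated x')`, whose last term is nonnegative. -/
theorem sum_price_le {a : Weights E} (ha : ∀ i j, 0 ≤ a i j) (σ : Equiv.Perm (Fin n))
    {x x' : Alloc E} (hx' : x' ∈ residual M (allocated x)) :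
    ∑ i, (matroidPricing M (additiveProfile a)).price i (x' i) (before σ x i) ≤
      ENNReal.ofReal (residualOpt M (additiveProfile a) (allocated x)) := by
  obtain ⟨hd, hind⟩ := hx'
  set R := residualOpt M (additiveProfile a)
  have hbd : ∀ k, bundle (σ k) (x' (σ k)) ⊆ allocated x' := by
    rintro k ⟨j, e⟩; simp only [mem_bundle, mem_allocated]; rintro ⟨s, hs, h⟩; cases h; exact hs
  have hstep : ∀ k : Fin n,
      M.Indep ((allocatedFirst σ x k ∪ bundle (σ k) (x' (σ k)) : Finset _) : Set (Σ i, E i)) :=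
    fun k => hind.subset (by
      exact_mod_cast Finset.union_subset_union (allocatedFirst_subset σ x k) (hbd k))
  calc _ = ∑ k : Fin n, ENNReal.ofReal (R (allocatedFirst σ x k) -
          R (allocatedFirst σ x k ∪ bundle (σ k) (x' (σ k)))) := by
        rw [← Equiv.sum_comp σ]
        refine Finset.sum_congr rfl fun k _ => ?_
        rw [matroidPricing_price_of_indep] <;> rw [allocated_before]
        exact hstep k
    _ ≤ ∑ k : Fin n, ENNReal.ofReal (R (allocated x ∪ allocatedFirst σ x' k) -
          R (allocated x ∪ allocatedFirst σ x' (k + 1))) := by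
        refine Finset.sum_le_sum fun k _ => ENNReal.ofReal_le_ofReal ?_
        rw [← allocatedFirst_union_bundle, ← Finset.union_assoc]
        refine residualOpt_sub_le_of_subset ?_ ?_ (hind.subset ?_)
        · exact (allocatedFirst_subset σ x k).trans Finset.subset_union_left
        · refine Finset.disjoint_union_left.2 ⟨hd.mono_right (hbd k), ?_⟩
          rw [Finset.disjoint_left]
          rintro ⟨j, e⟩ h1 h2
          simp only [mem_allocatedFirst] at h1
          obtain ⟨s, -, h⟩ := mem_bundle.1 h2
          cases h
          simp at h1
        · rw [Finset.union_assoc]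
          exact_mod_cast Finset.union_subset_union_right
            (Finset.union_subset (allocatedFirst_subset σ x' k) (hbd k))
    _ = ENNReal.ofReal (∑ k : Fin n, (R (allocated x ∪ allocatedFirst σ x' k) -
          R (allocated x ∪ allocatedFirst σ x' (k + 1)))) := by
        refine (ENNReal.ofReal_sum_of_nonneg fun k _ => sub_nonneg.2 (residualOpt_anti M _ ?_
          (hind.subset ?_))).symm
        · exact Finset.union_subset_union_right (allocatedFirst_mono σ x' (Nat.le_succ _))
        · exact_mod_cast Finset.union_subset_union_right (allocatedFirst_subset σ x' _)
    _ ≤ _ := by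
        rw [sum_sub_allocatedFirst σ x' fun S => R (allocated x ∪ S), Finset.union_empty]
        refine ENNReal.ofReal_le_ofReal (sub_le_self _ (residualOpt_nonneg ?_ _))
        exact fun i S => Finset.sum_nonneg fun j _ => ha i j

theorem exchangeCompatible_residual (M : Matroid (Σ i, E i)) :
    ExchangeCompatible M (fun x => residual M (allocated x)) := by
  intro x y hy i
  refine hy.2.subset ?_
  rintro ⟨j, e⟩ he
  by_cases hj : j = i
  · subst hj; simp at he; simp [he]
  · simp [hj] at he; simp [he]

/-- Prices that are based on an additive profile which supports `v` at the outcome of the rule `ALG`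
are balanced. -/
theorem isBalanced_of_supports {v : Profile E} {a : Weights E} {ALG : Profile E → Alloc E}
    (hALG : Feasible M (ALG v)) (ha : Supports a v (ALG v)) (σ : Equiv.Perm (Fin n)) :
    IsBalanced M v (matroidPricing M (additiveProfile a)) 1 1 ALG
      (fun x => residual M (allocated x)) σ where
  compatible := exchangeCompatible_residual M
  lower x hx := by
    rw [sum_price_eq _ _ hx]
    refine ENNReal.ofReal_le_ofReal ?_
    have h1 : welfare v (ALG v) ≤ residualOpt M (additiveProfile a) ∅ := by
      rw [show welfare v (ALG v) = welfare (additiveProfile a) (ALG v) from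
        Finset.sum_congr rfl fun i _ => (ha.eq i).symm]
      exact welfare_le_residualOpt _ (by rw [residual_empty]; exact hALG)
    have h2 := residualOpt_mono (M := M) ha.le (allocated x)
    change _ ≤ optWelfare v (residual M (allocated x)) at h2
    linarith
  upper x _ x' hx' := by
    refine (sum_price_le ha.nonneg σ hx').trans (ENNReal.ofReal_le_ofReal ?_)
    rw [one_mul]
    exact residualOpt_mono ha.le _

end Balanced

/-! ### Supporting additive profiles -/

section Support

variable {α : Type u}

/-- The weights `a` vanish outside of `z` and support `f` at `z`. -/
structure IsSupport (a : α → ℝ) (f : Finset α → ℝ) (z : Finset α) : Prop where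
  nonneg : ∀ j, 0 ≤ a j
  eq_zero : ∀ j ∉ z, a j = 0
  le : ∀ S, ∑ j ∈ S, a j ≤ f S
  eq : ∑ j ∈ z, a j = f z

variable [DecidableEq α] {f : Finset α → ℝ}

theorem IsSubmodular.nonneg (hf : IsSubmodular f) (S : Finset α) : 0 ≤ f S :=
  hf.empty ▸ hf.mono (Finset.empty_subset S)

theorem IsSubmodular.isSupport_empty (hf : IsSubmodular f) : IsSupport (fun _ => 0) f ∅ :=
  ⟨fun _ => le_rfl, fun _ _ => rfl, fun S => by simpa using hf.nonneg S, by simp [hf.empty]⟩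

/-- The new weight is the marginal value of `e` over `z`, which by submodularity is at most its
marginal value over `S ∩ z`. Since the old weights vanish outside `z`, the part `S ∩ z` carries all
other weight of `S`, and monotonicity passes from `insert e (S ∩ z)` to `S`. -/
theorem IsSubmodular.isSupport_insert (hf : IsSubmodular f) {a : α → ℝ} {z : Finset α}
    (h : IsSupport a f z) {e : α} (he : e ∉ z) :
    IsSupport (Function.update a e (f (insert e z) - f z)) f (insert e z) where
  nonneg j := by
    by_cases hj : j = e
    · subst hj; simpa using hf.mono (Finset.subset_insert _ _)
    · simpa [hj] using h.nonneg j
  eq_zero j hj := by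
    rw [Finset.mem_insert, not_or] at hj
    simpa [hj.1] using h.eq_zero j hj.2
  le S := by
    by_cases heS : e ∈ S
    · rw [Finset.sum_update_of_mem heS]
      have h1 : ∑ j ∈ S \ {e}, a j = ∑ j ∈ S ∩ z, a j := by
        refine (Finset.sum_subset (fun j hj => ?_) fun j hj hj' => h.eq_zero j fun hz => hj' ?_).symm
        · rw [Finset.mem_inter] at hj
          rw [Finset.mem_sdiff, Finset.mem_singleton]
          exact ⟨hj.1, fun h => he (h ▸ hj.2)⟩
        · exact Finset.mem_inter.2 ⟨(Finset.mem_sdiff.1 hj).1, hz⟩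
      have h2 := h.le (S ∩ z)
      have h3 := hf.submod (insert e (S ∩ z)) z
      have h4 : insert e (S ∩ z) ∪ z = insert e z := by grind
      have h5 : insert e (S ∩ z) ∩ z = S ∩ z := by grind
      have h6 : f (insert e (S ∩ z)) ≤ f S := hf.mono (by grind)
      rw [h4, h5] at h3
      linarith
    · rw [Finset.sum_update_of_notMem heS]; exact h.le S
  eq := by
    rw [Finset.sum_update_of_mem (Finset.mem_insert_self e z),
      show insert e z \ {e} = z by grind, h.eq]
    ring

/-- An additive valuation supports itself, a submodular one is supported by the marginals along any
enumeration of `z`, and an XOS one by an additive function that attains the maximum at `z`. -/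
theorem exists_support (hf : IsAdditive f ∨ IsSubmodular f ∨ IsXOS f) (z : Finset α) :
    ∃ a : α → ℝ, (∀ j, 0 ≤ a j) ∧ (∀ S, ∑ j ∈ S, a j ≤ f S) ∧ ∑ j ∈ z, a j = f z := by
  rcases hf with ⟨w, hw, h⟩ | hf | ⟨A, -, hA, h⟩
  · exact ⟨w, hw, fun S => (h S).ge, (h z).symm⟩
  · obtain ⟨a, ha⟩ : ∃ a, IsSupport a f z := by
      induction z using Finset.induction_on with
      | empty => exact ⟨_, hf.isSupport_empty⟩
      | insert e z he ih => exact ih.elim fun a ha => ⟨_, hf.isSupport_insert ha he⟩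
    exact ⟨a, ha.nonneg, ha.le, ha.eq⟩
  · obtain ⟨⟨a, ha, haz⟩, -⟩ := h z
    exact ⟨a, hA a ha, fun S => (h S).2 ⟨a, ha, rfl⟩, haz⟩

theorem exists_supports {n : ℕ} {E : Fin n → Type u} [∀ i, DecidableEq (E i)] {v : Profile E}
    (hv : ∀ i, IsAdditive (v i) ∨ IsSubmodular (v i) ∨ IsXOS (v i)) (z : Alloc E) :
    ∃ a, Supports a v z := by
  choose a h1 h2 h3 using fun i => exists_support (hv i) (z i)
  exact ⟨a, h1, h2, h3⟩

theorem GreedyStep.feasible_of_reflTransGen {n : ℕ} {E : Fin n → Type u} [∀ i, DecidableEq (E i)]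
    [∀ i, Fintype (E i)] {M : Matroid (Σ i, E i)} {v : Profile E} {g : Alloc E}
    (h : Relation.ReflTransGen (GreedyStep M v) (fun _ => ∅) g) : Feasible M g := by
  cases h with
  | refl => exact feasible_empty
  | tail _ h => obtain ⟨i, e, -, -, h, -⟩ := h; exact h

end Support

/-! ### The approximation factor of greedy -/

section GreedyApproximation

/-- `O` is what remains of an optimal solution when greedy holds `G`. If `e` pushes an element `c`
out of `O`, submodularity bounds the loss by the marginal of `c` over `G`. Since `c` was available
to greedy, this is at most the marginal of `e`, by which the value of `G` grows. Hence `f (G ∪ O) +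
f G` never decreases. -/
theorem exists_greedy_exchange {α : Type u} [DecidableEq α] {M : Matroid α} {f : Finset α → ℝ}
    (hf : IsSubmodular f) {G O : Finset α} (hd : Disjoint G O)
    (hGO : M.Indep ((G ∪ O : Finset α) : Set α)) {e : α} (he : e ∉ G)
    (heG : M.Indep ((insert e G : Finset α) : Set α))
    (hmax : ∀ c ∉ G, M.Indep ((insert c G : Finset α) : Set α) → f (insert c G) ≤ f (insert e G)) :
    ∃ O', Disjoint (insert e G) O' ∧ M.Indep ((insert e G ∪ O' : Finset α) : Set α) ∧
      f (G ∪ O) + f G ≤ f (insert e G ∪ O') + f (insert e G) := by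
  have hG : f G ≤ f (insert e G) := hf.mono (Finset.subset_insert _ _)
  rw [Finset.disjoint_left] at hd
  by_cases heO : e ∈ O
  · have : insert e G ∪ O.erase e = G ∪ O := by grind
    refine ⟨O.erase e, ?_, by rwa [this], by rw [this]; linarith⟩
    rw [Finset.disjoint_left]; grind
  by_cases hin : M.Indep (insert e ((G ∪ O : Finset α) : Set α))
  · refine ⟨O, by rw [Finset.disjoint_left]; grind, ?_, ?_⟩
    · rwa [Finset.insert_union, Finset.coe_insert]
    · have : f (G ∪ O) ≤ f (insert e G ∪ O) := hf.mono (by grind)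
      linarith
  obtain ⟨c, hcI, hcK, h1, h2⟩ := exists_symm_exchange hGO heG (b := e) (by simp) hin
  have hcI : c ∈ G ∪ O := hcI
  have hcK : c ∉ insert e G := hcK
  have hcG : c ∉ G := fun h => hcK (Finset.mem_insert_of_mem h)
  have hc := hmax c hcG (h2.subset (by intro j; simp; grind))
  refine ⟨O.erase c, by rw [Finset.disjoint_left]; grind, h1.subset ?_, ?_⟩
  · intro j; simp; grind
  · have h3 := hf.submod ((G ∪ O).erase c) (insert c G)
    rw [show (G ∪ O).erase c ∪ insert c G = G ∪ O by grind,
      show (G ∪ O).erase c ∩ insert c G = G by grind] at h3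
    have h4 : f ((G ∪ O).erase c) ≤ f (insert e G ∪ O.erase c) := hf.mono (by grind)
    linarith

variable {n : ℕ} {E : Fin n → Type u} [∀ i, DecidableEq (E i)] [∀ i, Fintype (E i)]
  {M : Matroid (Σ i, E i)} {v : Profile E}

theorem isSubmodular_welfare_allocOf (hv : ∀ i, IsSubmodular (v i)) :
    IsSubmodular fun S : Finset (Σ i, E i) => welfare v (allocOf S) where
  empty := by
    have : allocOf (∅ : Finset (Σ i, E i)) = fun _ => ∅ := by ext; simp
    simp [this, welfare, (hv _).empty]
  mono S T h := Finset.sum_le_sum fun i _ => (hv i).mono fun e he => by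
    rw [mem_allocOf] at *; exact h he
  submod S T := by
    simp only [welfare, ← Finset.sum_add_distrib]
    refine Finset.sum_le_sum fun i _ => ?_
    have h1 : allocOf (S ∪ T) i = allocOf S i ∪ allocOf T i := by ext; simp
    have h2 : allocOf (S ∩ T) i = allocOf S i ∩ allocOf T i := by ext; simp
    rw [h1, h2]
    exact (hv i).submod _ _

/-- The element `e` is not used in `x` and can be added to it. -/
def Addable (M : Matroid (Σ i, E i)) (x : Alloc E) (e : Σ i, E i) : Prop :=
  e.2 ∉ x e.1 ∧ Feasible M (Function.update x e.1 (insert e.2 (x e.1)))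

/-- The value that `e` adds to the bundle of its owner. -/
def marginal (v : Profile E) (x : Alloc E) (e : Σ i, E i) : ℝ :=
  v e.1 (insert e.2 (x e.1)) - v e.1 (x e.1)

theorem welfare_update_insert (v : Profile E) (x : Alloc E) (e : Σ i, E i) :
    welfare v (Function.update x e.1 (insert e.2 (x e.1))) = welfare v x + marginal v x e := by
  obtain ⟨i, e⟩ := e
  have : ∀ y : Alloc E, welfare v y = v i (y i) + ∑ j ∈ Finset.univ.erase i, v j (y j) := fun y =>
    (Finset.add_sum_erase _ _ (Finset.mem_univ i)).symm
  rw [this, this x, Finset.sum_congr rfl (g := fun j => v j (x j)) fun j hj => by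
    rw [Function.update_of_ne (Finset.ne_of_mem_erase hj)]]
  simp [marginal]
  ring

/-- `e` has the largest increment `m` among the elements that can be added to `x`. -/
def IsBest (M : Matroid (Σ i, E i)) (x : Alloc E) (m : (Σ i, E i) → ℝ) (e : Σ i, E i) : Prop :=
  Addable M x e ∧ ∀ f, Addable M x f → m f ≤ m e

theorem IsBest.greedyStep {x : Alloc E} {e : Σ i, E i} (h : IsBest M x (marginal v x) e) :
    GreedyStep M v x (Function.update x e.1 (insert e.2 (x e.1))) := by
  refine ⟨e.1, e.2, h.1.1, rfl, h.1.2, fun j f hf hfeas => ?_⟩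
  have h1 := welfare_update_insert v x ⟨j, f⟩
  have h2 := welfare_update_insert v x e
  have h3 := h.2 ⟨j, f⟩ ⟨hf, hfeas⟩
  simp only at h1
  rw [h1, h2]
  linarith

theorem exists_isBest {x : Alloc E} (m : (Σ i, E i) → ℝ) (h : ∃ e, Addable M x e) :
    ∃ e, IsBest M x m e := by
  obtain ⟨e, he, hmax⟩ := Set.exists_max_image {e | Addable M x e} m (Set.toFinite _) h
  exact ⟨e, he, hmax⟩

theorem not_greedyStep_of_not_addable {x : Alloc E} (h : ¬ ∃ e, Addable M x e) (y : Alloc E) :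
    ¬ GreedyStep M v x y := by
  rintro ⟨i, e, he, rfl, hf, -⟩
  exact h ⟨⟨i, e⟩, he, hf⟩

/-- The greedy algorithm is a `2`-approximation for submodular valuations. -/
theorem residualOpt_empty_le_two_mul (hv : ∀ i, IsSubmodular (v i)) {g : Alloc E}
    (hg : IsGreedyOutput M v g) : residualOpt M v ∅ ≤ 2 * welfare v g := by
  set f := fun S : Finset (Σ i, E i) => welfare v (allocOf S) with hfdef
  have hf : IsSubmodular f := isSubmodular_welfare_allocOf hv
  have hfx : ∀ x, f (allocated x) = welfare v x := fun x => by simp [f]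
  obtain ⟨o, ho, how⟩ := exists_welfare_eq_residualOpt (M := M) (S := ∅) v (by simp)
  rw [residual_empty] at ho
  -- Invariant of the greedy run: it starts with `O` equal to the optimum. At the end `O` is empty,
  -- since any of its elements could still be added, and the bound becomes twice the greedy welfare.
  have key : ∀ g, Relation.ReflTransGen (GreedyStep M v) (fun _ => ∅) g →
      ∃ O, Disjoint (allocated g) O ∧ M.Indep ((allocated g ∪ O : Finset _) : Set _) ∧
      welfare v o ≤ f (allocated g ∪ O) + f (allocated g) := by
    intro g hg
    induction hg with
    | refl =>
      refine ⟨allocated o, ?_⟩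
      simp only [allocated_empty, Finset.empty_union, Finset.disjoint_empty_left, true_and]
      exact ⟨ho, by rw [hfx, hf.empty, add_zero]⟩
    | @tail b c _ hstep ih =>
      obtain ⟨O, hd, hO, hle⟩ := ih
      obtain ⟨i, e, he, rfl, hfeas, hmax⟩ := hstep
      rw [allocated_update_insert]
      rw [Feasible, allocated_update_insert] at hfeas
      obtain ⟨O', h1, h2, h3⟩ := exists_greedy_exchange hf hd hO (e := ⟨i, e⟩) (by simpa) hfeas
        (fun c hc hcf => by
          have := hmax c.1 c.2 (by simpa using hc) (by rwa [Feasible, allocated_update_insert])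
          rwa [← hfx, ← hfx, allocated_update_insert, allocated_update_insert] at this)
      exact ⟨O', h1, h2, hle.trans h3⟩
  obtain ⟨O, hd, hO, hle⟩ := key g hg.1
  obtain rfl : O = ∅ := by
    by_contra hne
    obtain ⟨e, he⟩ := Finset.nonempty_iff_ne_empty.2 hne
    obtain ⟨e', he'⟩ := exists_isBest (M := M) (x := g) (marginal v g) ⟨e,
      by simpa using Finset.disjoint_right.1 hd he, by
        rw [Feasible, allocated_update_insert]
        exact hO.subset (by intro j; simp; rintro (rfl | h) <;> simp [*])⟩
    exact hg.2 _ he'.greedyStep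
  rw [Finset.union_empty, hfx] at hle
  linarith

end GreedyApproximation

/-! ### Greedy weights from value queries -/

section GreedyAlgorithm

variable {n : ℕ} {E : Fin n → Type u} [∀ i, DecidableEq (E i)] [∀ i, Fintype (E i)]

open Classical in
/-- One step of the greedy algorithm, given the increments `m`. The second component of the state
records the increments of the elements that have been added. -/
noncomputable def greedyNext (M : Matroid (Σ i, E i)) (m : (Σ i, E i) → ℝ)
    (s : Alloc E × Weights E) : Alloc E × Weights E :=
  if h : ∃ e, IsBest M s.1 m e then
    (Function.update s.1 h.choose.1 (insert h.choose.2 (s.1 h.choose.1)),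
      Function.update s.2 h.choose.1 (Function.update (s.2 h.choose.1) h.choose.2 (m h.choose)))
  else s

noncomputable def greedyState (M : Matroid (Σ i, E i)) (v : Profile E) (k : ℕ) :
    Alloc E × Weights E :=
  (fun s => greedyNext M (marginal v s.1) s)^[k] (fun _ => ∅, fun _ _ => 0)

/-- The increments of the elements that the greedy algorithm adds. -/
noncomputable def greedyWeights (M : Matroid (Σ i, E i)) (v : Profile E) : Weights E :=
  -- One step more than there are elements: while an element can be added every step has added one,
  -- so an unfinished run would have allocated more than the ground set. Steps after the end change
  -- nothing.
  (greedyState M v (Fintype.card (Σ i, E i) + 1)).2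

variable {M : Matroid (Σ i, E i)} {v : Profile E}

/-- The last clause measures progress and gives termination. The middle one holds because the
recorded increments are the marginals that `IsSubmodular.isSupport_insert` asks for. -/
theorem greedyState_spec (hv : ∀ i, IsSubmodular (v i)) (k : ℕ) :
    Relation.ReflTransGen (GreedyStep M v) (fun _ => ∅) (greedyState M v k).1 ∧
      (∀ i, IsSupport ((greedyState M v k).2 i) (v i) ((greedyState M v k).1 i)) ∧
      ((∃ e, Addable M (greedyState M v k).1 e) → k ≤ (allocated (greedyState M v k).1).card) := by
  induction k with
  | zero => exact ⟨.refl, fun i => (hv i).isSupport_empty, fun _ => Nat.zero_le _⟩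
  | succ k ih =>
    have hs : greedyState M v (k + 1) =
      greedyNext M (marginal v (greedyState M v k).1) (greedyState M v k) :=
      Function.iterate_succ_apply' _ _ _
    set s := greedyState M v k
    rw [hs, greedyNext]
    split_ifs with h
    · obtain ⟨h1, h2, h3⟩ := ih
      have hb := h.choose_spec
      set e := h.choose
      refine ⟨h1.tail hb.greedyStep, fun i => ?_, fun _ => ?_⟩
      · by_cases hi : i = e.1
        · subst hi
          simp only [Function.update_self]
          exact (hv _).isSupport_insert (h2 _) hb.1.1
        · simpa [hi] using h2 i
      · simp only [allocated_update_insert]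
        rw [Finset.card_insert_of_notMem (by simpa using hb.1.1)]
        exact Nat.succ_le_succ (h3 ⟨e, hb.1⟩)
    · exact ⟨ih.1, ih.2.1, fun h' => absurd (exists_isBest _ h') h⟩

theorem exists_isGreedyOutput_supports (M : Matroid (Σ i, E i)) (hv : ∀ i, IsSubmodular (v i)) :
    ∃ g, IsGreedyOutput M v g ∧ Supports (greedyWeights M v) v g := by
  obtain ⟨h1, h2, h3⟩ := greedyState_spec (M := M) hv (Fintype.card (Σ i, E i) + 1)
  refine ⟨_, ⟨h1, not_greedyStep_of_not_addable fun h => ?_⟩,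
    fun i => (h2 i).nonneg, fun i => (h2 i).le, fun i => (h2 i).eq⟩
  exact absurd ((h3 h).trans (Finset.card_le_univ _)) (by simp)

variable {N : ℕ} {β : Type u}

/-- Query the increments of the listed elements for the allocation `x` and record them in `m`. -/
def queryMarginals (t : Fin N) (x : Alloc E) :
    List (Σ i, E i) → ((Σ i, E i) → ℝ) → (((Σ i, E i) → ℝ) → ValueQueryAlg N E β) →
      ValueQueryAlg N E β
  | [], m, k => k m
  | e :: l, m, k => .query t e.1 (insert e.2 (x e.1)) fun r => .query t e.1 (x e.1) fun s =>
      queryMarginals t x l (Function.update m e (r - s)) k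

theorem run_queryMarginals (w : Fin N → Profile E) (t : Fin N) (x : Alloc E) (l : List (Σ i, E i))
    (m : (Σ i, E i) → ℝ) (k : ((Σ i, E i) → ℝ) → ValueQueryAlg N E β) :
    (queryMarginals t x l m k).run w =
        (k fun e => if e ∈ l then marginal (w t) x e else m e).run w ∧
      (queryMarginals t x l m k).numQueries w = 2 * l.length +
        (k fun e => if e ∈ l then marginal (w t) x e else m e).numQueries w := by
  induction l generalizing m with
  | nil => simp [queryMarginals]
  | cons e l ih =>
    have : (fun f => if f ∈ l then marginal (w t) x f else
        Function.update m e (marginal (w t) x e) f) =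
        fun f => if f ∈ e :: l then marginal (w t) x f else m f := by
      ext f
      by_cases hf : f = e
      · subst hf; simp
      · simp [hf]
    obtain ⟨h1, h2⟩ := ih (Function.update m e (marginal (w t) x e))
    rw [this] at h1 h2
    refine ⟨h1, ?_⟩
    change (queryMarginals t x l (Function.update m e (marginal (w t) x e)) k).numQueries w + 1 + 1
      = _
    rw [h2, List.length_cons]
    ring

/-- Run `j` steps of the greedy algorithm on the sample `t`. -/
noncomputable def queryGreedy (M : Matroid (Σ i, E i)) (t : Fin N) :
    ℕ → Alloc E × Weights E → (Weights E → ValueQueryAlg N E β) → ValueQueryAlg N E β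
  | 0, s, k => k s.2
  -- All elements are queried, addable or not, so the recorded function is exactly `marginal` and
  -- `greedyNext` makes the same choice as in `greedyState`, ties included.
  | j + 1, s, k => queryMarginals t s.1 Finset.univ.toList (fun _ => 0) fun m =>
      queryGreedy M t j (greedyNext M m s) k

theorem run_queryGreedy (w : Fin N → Profile E) (t : Fin N) (j : ℕ) (s : Alloc E × Weights E)
    (k : Weights E → ValueQueryAlg N E β) :
    (queryGreedy M t j s k).run w =
        (k ((fun s => greedyNext M (marginal (w t) s.1) s)^[j] s).2).run w ∧
      (queryGreedy M t j s k).numQueries w = j * (2 * Fintype.card (Σ i, E i)) +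
        (k ((fun s => greedyNext M (marginal (w t) s.1) s)^[j] s).2).numQueries w := by
  induction j generalizing s with
  | zero => simp [queryGreedy]
  | succ j ih =>
    obtain ⟨h1, h2⟩ := run_queryMarginals w t s.1 Finset.univ.toList (fun _ => 0) fun m =>
      queryGreedy M t j (greedyNext M m s) k
    simp only [Finset.mem_toList, Finset.mem_univ, if_true, Finset.length_toList,
      Finset.card_univ] at h1 h2
    obtain ⟨h3, h4⟩ := ih (greedyNext M (marginal (w t) s.1) s)
    refine ⟨h1.trans h3, h2.trans ?_⟩
    rw [Function.iterate_succ_apply]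
    change _ + (queryGreedy M t j (greedyNext M (marginal (w t) s.1) s) k).numQueries w = _
    rw [h4]
    ring

/-- Compute the greedy weights of the listed samples and record them in `b`. -/
noncomputable def querySamples (M : Matroid (Σ i, E i)) :
    List (Fin N) → (Fin N → Weights E) → ((Fin N → Weights E) → ValueQueryAlg N E β) →
      ValueQueryAlg N E β
  | [], b, k => k b
  | t :: l, b, k => queryGreedy M t (Fintype.card (Σ i, E i) + 1) (fun _ => ∅, fun _ _ => 0) fun a =>
      querySamples M l (Function.update b t a) k

theorem run_querySamples (w : Fin N → Profile E) (l : List (Fin N)) (b : Fin N → Weights E)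
    (k : (Fin N → Weights E) → ValueQueryAlg N E β) :
    (querySamples M l b k).run w =
        (k fun t => if t ∈ l then greedyWeights M (w t) else b t).run w ∧
      (querySamples M l b k).numQueries w =
        l.length * ((Fintype.card (Σ i, E i) + 1) * (2 * Fintype.card (Σ i, E i))) +
        (k fun t => if t ∈ l then greedyWeights M (w t) else b t).numQueries w := by
  induction l generalizing b with
  | nil => simp [querySamples]
  | cons t l ih =>
    have : (fun f => if f ∈ l then greedyWeights M (w f) else
        Function.update b t (greedyWeights M (w t)) f) =
        fun f => if f ∈ t :: l then greedyWeights M (w f) else b f := by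
      ext f
      by_cases hf : f = t
      · subst hf; simp
      · simp [hf]
    obtain ⟨h1, h2⟩ := ih (Function.update b t (greedyWeights M (w t)))
    rw [this] at h1 h2
    obtain ⟨h3, h4⟩ := run_queryGreedy (M := M) w t (Fintype.card (Σ i, E i) + 1)
      (fun _ => ∅, fun _ _ => 0) fun a => querySamples M l (Function.update b t a) k
    refine ⟨h3.trans h1, h4.trans ?_⟩
    change _ + (querySamples M l (Function.update b t (greedyWeights M (w t))) k).numQueries w = _
    rw [h2, List.length_cons]
    ring

/-- Half of the average of the prices that belong to the additive profiles with weights `b t`. -/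
noncomputable def averagePricing [NeZero N] (M : Matroid (Σ i, E i)) (b : Fin N → Weights E) :
    PricingRule M where
  price i S y :=
    2⁻¹ * ((N : ℝ≥0∞)⁻¹ * ∑ t, (matroidPricing M (additiveProfile (b t))).price i S y)
  infeasible i S y h := by
    simp [(matroidPricing M _).infeasible i S y h, ENNReal.mul_top, NeZero.ne]
  null i y h := by simp [(matroidPricing M _).null i y h]

/-- The algorithm that computes the greedy prices of all samples and takes half of their average. -/
noncomputable def sampleAlg (N : ℕ) [NeZero N] (M : Matroid (Σ i, E i)) :
    ValueQueryAlg N E (PricingRule M) :=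
  querySamples M (List.finRange N) (fun _ _ _ => 0) fun b => .done (averagePricing M b)

theorem run_sampleAlg [NeZero N] (w : Fin N → Profile E) :
    (sampleAlg N M).run w = averagePricing M fun t => greedyWeights M (w t) := by
  rw [sampleAlg, (run_querySamples w _ _ _).1]
  simp [ValueQueryAlg.run]

theorem numQueries_sampleAlg [NeZero N] (w : Fin N → Profile E) :
    (sampleAlg N M).numQueries w =
      N * ((Fintype.card (Σ i, E i) + 1) * (2 * Fintype.card (Σ i, E i))) := by
  rw [sampleAlg, (run_querySamples w _ _ _).2]
  simp [ValueQueryAlg.numQueries]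

end GreedyAlgorithm

/-! ### Resampling a coordinate and measurable selection -/

section Measure

/-- Swapping one coordinate of two independent samples from a product measure preserves the joint
distribution. -/
theorem measurePreserving_swap_coordinate {ι : Type*} [Fintype ι] [DecidableEq ι] {Ω : ι → Type*}
    [∀ i, MeasurableSpace (Ω i)] (μ : ∀ i, Measure (Ω i)) [∀ i, IsProbabilityMeasure (μ i)]
    (i : ι) :
    MeasurePreserving (fun q : (∀ i, Ω i) × (∀ i, Ω i) =>
        (Function.update q.1 i (q.2 i), Function.update q.2 i (q.1 i)))
      ((Measure.pi μ).prod (Measure.pi μ)) ((Measure.pi μ).prod (Measure.pi μ)) := by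
  have hm : Measurable fun q : (∀ i, Ω i) × (∀ i, Ω i) =>
      (Function.update q.1 i (q.2 i), Function.update q.2 i (q.1 i)) := by
    refine Measurable.prodMk ?_ ?_ <;> refine measurable_pi_lambda _ fun j => ?_
    all_goals
      by_cases h : j = i
      · subst h; simp only [Function.update_self]; fun_prop
      · simp only [Function.update_of_ne h]; fun_prop
  -- Boxes form a generating π-system. The preimage of a pair of boxes is the pair with their `i`-th
  -- sides exchanged, which has the same product measure.
  refine ⟨hm, (Measure.prod_eq_generateFrom (C := Set.pi Set.univ '' Set.pi Set.univ fun i =>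
    {s : Set (Ω i) | MeasurableSet s}) (D := Set.pi Set.univ '' Set.pi Set.univ fun i =>
    {s : Set (Ω i) | MeasurableSet s}) generateFrom_pi generateFrom_pi isPiSystem_pi isPiSystem_pi
    ?_ ?_ ?_).symm⟩
  · exact ⟨fun _ => Set.univ, fun _ => ⟨fun _ => Set.univ, by simp, by simp⟩,
      fun _ => measure_lt_top _ _, Set.iUnion_const _⟩
  · exact ⟨fun _ => Set.univ, fun _ => ⟨fun _ => Set.univ, by simp, by simp⟩,
      fun _ => measure_lt_top _ _, Set.iUnion_const _⟩
  · rintro _ ⟨s, hs, rfl⟩ _ ⟨t, ht, rfl⟩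
    have hs' : ∀ j, MeasurableSet (s j) := fun j => hs j trivial
    have ht' : ∀ j, MeasurableSet (t j) := fun j => ht j trivial
    rw [Measure.map_apply hm ((MeasurableSet.univ_pi hs').prod (MeasurableSet.univ_pi ht'))]
    have : (fun q : (∀ i, Ω i) × (∀ i, Ω i) =>
        (Function.update q.1 i (q.2 i), Function.update q.2 i (q.1 i))) ⁻¹'
          (Set.univ.pi s ×ˢ Set.univ.pi t) =
        Set.univ.pi (Function.update s i (t i)) ×ˢ Set.univ.pi (Function.update t i (s i)) := by
      ext ⟨x, y⟩
      simp only [Set.mem_preimage, Set.mem_prod, Set.mem_pi, Set.mem_univ, true_imp_iff]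
      constructor
      · rintro ⟨h1, h2⟩
        refine ⟨fun j => ?_, fun j => ?_⟩ <;> by_cases h : j = i
        · subst h; simpa using h2 j
        · simpa [h] using h1 j
        · subst h; simpa using h1 j
        · simpa [h] using h2 j
      · rintro ⟨h1, h2⟩
        refine ⟨fun j => ?_, fun j => ?_⟩ <;> by_cases h : j = i
        · subst h; simpa using h2 j
        · simpa [h] using h1 j
        · subst h; simpa using h1 j
        · simpa [h] using h2 j
    rw [this, Measure.prod_prod, Measure.pi_pi, Measure.pi_pi, Measure.pi_pi, Measure.pi_pi]
    simp only [← Finset.prod_mul_distrib]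
    refine Finset.prod_congr rfl fun j _ => ?_
    by_cases h : j = i
    · subst h; simp [mul_comm]
    · simp [h]

variable {Ω : Type*} [MeasurableSpace Ω] {ι : Type*}

/-- Measurability and integrability of a selected function thus reduce to measurability of the level
sets of `Y`, with no σ-algebra on `ι`. -/
theorem select_eq_sum_indicator [Fintype ι] (Y : Ω → ι) (f : ι → Ω → ℝ) :
    (fun ω => f (Y ω) ω) = fun ω => ∑ z, Set.indicator {ω | Y ω = z} (f z) ω := by
  classical
  ext ω
  rw [Finset.sum_eq_single (Y ω)]
  · simp
  · intro z _ hz; rw [Set.indicator_of_notMem]; exact fun h => hz (Eq.symm h)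
  · simp

theorem measurable_select [Fintype ι] {Y : Ω → ι} (hY : ∀ z, MeasurableSet {ω | Y ω = z})
    {f : ι → Ω → ℝ} (hf : ∀ z, Measurable (f z)) : Measurable fun ω => f (Y ω) ω := by
  rw [select_eq_sum_indicator]
  exact Finset.measurable_sum _ fun z _ => (hf z).indicator (hY z)

theorem integrable_select [Fintype ι] {μ : Measure Ω} {Y : Ω → ι}
    (hY : ∀ z, MeasurableSet {ω | Y ω = z}) {f : ι → Ω → ℝ} (hf : ∀ z, Integrable (f z) μ) :
    Integrable (fun ω => f (Y ω) ω) μ := by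
  rw [select_eq_sum_indicator]
  exact integrable_finsetSum _ fun z _ => (hf z).indicator (hY z)

/-- A maximizer over a finite set can be chosen in a measurable way. -/
theorem exists_measurable_argmax {f : ι → Ω → ℝ} (hf : ∀ z, Measurable (f z)) {s : Set ι}
    (hfin : s.Finite) (hs : s.Nonempty) :
    ∃ Y : Ω → ι, (∀ z, MeasurableSet {ω | Y ω = z}) ∧ ∀ ω, Y ω ∈ s ∧ ∀ z ∈ s, f z ω ≤ f (Y ω) ω := by
  classical
  lift s to Finset ι using hfin
  rw [Finset.coe_nonempty] at hs
  -- The attained maximum is carried along as a measurable function, because the induction compares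
  -- it with the value at the new point.
  suffices H : ∃ Y : Ω → ι, (∀ z, MeasurableSet {ω | Y ω = z}) ∧
      (Measurable fun ω => f (Y ω) ω) ∧ ∀ ω, Y ω ∈ s ∧ ∀ z ∈ s, f z ω ≤ f (Y ω) ω by
    obtain ⟨Y, h1, -, h2⟩ := H
    exact ⟨Y, h1, h2⟩
  induction hs using Finset.Nonempty.cons_induction with
  | singleton a => exact ⟨fun _ => a, fun z => MeasurableSet.const _, hf a, by simp⟩
  | cons a s ha hs ih =>
    obtain ⟨Y, h1, h2, h3⟩ := ih
    have hA : MeasurableSet {ω | f (Y ω) ω ≤ f a ω} := measurableSet_le h2 (hf a)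
    refine ⟨fun ω => if f (Y ω) ω ≤ f a ω then a else Y ω, fun z => ?_, ?_, fun ω => ?_⟩
    · have : {ω | (if f (Y ω) ω ≤ f a ω then a else Y ω) = z} =
          ({ω | f (Y ω) ω ≤ f a ω} ∩ {_ω | a = z}) ∪ ({ω | f (Y ω) ω ≤ f a ω}ᶜ ∩ {ω | Y ω = z}) := by
        ext ω
        by_cases h : f (Y ω) ω ≤ f a ω <;> simp [h]
      rw [this]
      exact (hA.inter (MeasurableSet.const _)).union (hA.compl.inter (h1 z))
    · have : (fun ω => f (if f (Y ω) ω ≤ f a ω then a else Y ω) ω) =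
          fun ω => if f (Y ω) ω ≤ f a ω then f a ω else f (Y ω) ω := by
        ext ω; split_ifs <;> rfl
      rw [this]
      exact Measurable.ite hA (hf a) h2
    · simp only [Finset.mem_cons, forall_eq_or_imp]
      split_ifs with h
      · exact ⟨.inl rfl, le_rfl, fun z hz => ((h3 ω).2 z hz).trans h⟩
      · exact ⟨.inr (h3 ω).1, (not_le.1 h).le, (h3 ω).2⟩

end Measure

/-! ### Welfare of posted prices -/

section Mechanism

variable {n : ℕ} {E : Fin n → Type u} [∀ i, DecidableEq (E i)] [∀ i, Fintype (E i)]
  {M : Matroid (Σ i, E i)}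

theorem measurable_welfare (x : Alloc E) : Measurable fun v : Profile E => welfare v x := by
  unfold welfare; fun_prop

theorem exists_measurable_residual_argmax {S : Finset (Σ i, E i)}
    (hS : M.Indep (S : Set (Σ i, E i))) :
    ∃ T : Profile E → Alloc E, (∀ z, MeasurableSet {v | T v = z}) ∧
      ∀ v, T v ∈ residual M S ∧ welfare v (T v) = residualOpt M v S := by
  obtain ⟨T, h1, h2⟩ := exists_measurable_argmax (f := fun x v => welfare v x) measurable_welfare
    (Set.toFinite (residual M S)) ⟨_, empty_mem_residual hS⟩
  refine ⟨T, h1, fun v => ⟨(h2 v).1, le_antisymm (welfare_le_residualOpt v (h2 v).1) ?_⟩⟩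
  obtain ⟨t, ht, h⟩ := exists_welfare_eq_residualOpt v hS
  exact h ▸ (h2 v).2 t ht

theorem measurable_residualOpt (S : Finset (Σ i, E i)) :
    Measurable fun v : Profile E => residualOpt M v S := by
  by_cases hS : M.Indep (S : Set (Σ i, E i))
  · obtain ⟨T, h1, h2⟩ := exists_measurable_residual_argmax hS
    simp only [← (h2 _).2]
    exact measurable_select h1 measurable_welfare
  · simp only [residualOpt_of_not_indep _ hS, measurable_const]

variable {D : ∀ i, Measure (Finset (E i) → ℝ)} [∀ i, IsProbabilityMeasure (D i)]

theorem ae_pi_of_ae {P : ∀ i, (Finset (E i) → ℝ) → Prop} (h : ∀ i, ∀ᵐ f ∂(D i), P i f) :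
    ∀ᵐ v ∂(Measure.pi D), ∀ i, P i (v i) :=
  ae_all_iff.2 fun i => (Measure.tendsto_eval_ae_ae (i := i)).eventually (h i)

theorem integrable_value (hD : ∀ i, ∀ᵐ f ∂(D i), ∀ S, 0 ≤ f S ∧ f S ≤ 1) (i : Fin n)
    (S : Finset (E i)) : Integrable (fun v : Profile E => v i S) (Measure.pi D) := by
  refine Integrable.of_mem_Icc 0 1
    ((measurable_pi_apply S).comp (measurable_pi_apply i)).aemeasurable ?_
  filter_upwards [ae_pi_of_ae hD] with v hv using hv i S

theorem integrable_welfare (hD : ∀ i, ∀ᵐ f ∂(D i), ∀ S, 0 ≤ f S ∧ f S ≤ 1) (x : Alloc E) :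
    Integrable (fun v : Profile E => welfare v x) (Measure.pi D) :=
  integrable_finsetSum _ fun i _ => integrable_value hD i _

theorem ae_residualOpt_mem_Icc (hD : ∀ i, ∀ᵐ f ∂(D i), ∀ S, 0 ≤ f S ∧ f S ≤ 1) :
    ∀ᵐ v ∂(Measure.pi D), ∀ S, residualOpt M v S ∈ Set.Icc (0 : ℝ) n := by
  filter_upwards [ae_pi_of_ae hD] with v hv S
  exact ⟨residualOpt_nonneg (fun i S => (hv i S).1) S, residualOpt_le (fun i S => (hv i S).2) S⟩

theorem integrable_residualOpt (hD : ∀ i, ∀ᵐ f ∂(D i), ∀ S, 0 ≤ f S ∧ f S ≤ 1)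
    (S : Finset (Σ i, E i)) : Integrable (fun v => residualOpt M v S) (Measure.pi D) := by
  refine Integrable.of_mem_Icc 0 n (measurable_residualOpt S).aemeasurable ?_
  filter_upwards [ae_residualOpt_mem_Icc hD] with v hv using hv S

variable {p : PricingRule M} {σ : Equiv.Perm (Fin n)} {X : Profile E → Alloc E}

/-- The null outcome is free and has finite utility, while the price `⊤` gives utility `⊥`. -/
theorem price_ne_top_of_maximizes {i : Fin n} {f : Finset (E i) → ℝ} {y : Alloc E}
    {S : Finset (E i)} (hy : Feasible M y) (h : utility p i f y ∅ ≤ utility p i f y S) :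
    p.price i S y ≠ ⊤ := by
  intro htop
  rw [utility, utility, htop, p.null i y hy] at h
  simp at h

theorem before_congr {x y : Alloc E} {i : Fin n}
    (h : ∀ j, σ.symm j < σ.symm i → x j = y j) : before σ x i = before σ y i := by
  ext1 j
  unfold before
  split_ifs with hj
  · exact h j hj
  · rfl

/-- The induction follows the arrival order: the null outcome is known to be free only at a feasible
partial allocation, and this is what keeps the next agent from paying `∞` for an infeasible one. -/
theorem IsOutcomeMap.before_feasible (hX : IsOutcomeMap p σ X) (v : Profile E) (k : ℕ)
    (hk : k ≤ n) : M.Indep (allocatedFirst σ (X v) k : Set (Σ i, E i)) := by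
  induction k with
  | zero => simp [allocatedFirst_zero]
  | succ k ih =>
    have ih := ih (by omega)
    let m : Fin n := ⟨k, hk⟩
    have hb : allocated (before σ (X v) (σ m)) = allocatedFirst σ (X v) k := allocated_before σ _ m
    have hy : Feasible M (before σ (X v) (σ m)) := by rwa [Feasible, hb]
    have hp := price_ne_top_of_maximizes hy (hX.maximizes v (σ m) ∅)
    have hf : Feasible M (Function.update (before σ (X v) (σ m)) (σ m) (X v (σ m))) := by
      by_contra h
      exact hp (p.infeasible _ _ _ h)
    refine hf.subset ?_
    have := allocatedFirst_union_bundle σ (X v) m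
    rw [show (m : ℕ) = k from rfl, ← hb] at this
    rw [← this]
    intro ⟨j, e⟩ he
    by_cases hj : j = σ m
    · subst hj
      simp only [Finset.coe_union, Set.mem_union, Finset.mem_coe, mem_allocated, before,
        lt_irrefl, if_false, Finset.notMem_empty, false_or] at he
      obtain ⟨s, hs, h⟩ := mem_bundle.1 he
      cases h
      simpa using hs
    · have hne : ⟨j, e⟩ ∉ bundle (σ m) (X v (σ m)) := by
        rw [mem_bundle]; rintro ⟨s, -, h⟩; cases h; exact hj rfl
      simp only [Finset.coe_union, Set.mem_union, Finset.mem_coe, hne, or_false] at he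
      simpa [hj] using he

theorem IsOutcomeMap.feasible (hX : IsOutcomeMap p σ X) (v : Profile E) : Feasible M (X v) := by
  have := hX.before_feasible v n le_rfl
  rwa [allocatedFirst_top] at this

theorem feasible_before {x : Alloc E} (hx : Feasible M x) (i : Fin n) :
    Feasible M (before σ x i) := by
  refine hx.subset ?_
  rintro ⟨j, e⟩ he
  simp only [Finset.mem_coe, mem_allocated, before] at he ⊢
  split_ifs at he
  · exact he
  · simp at he

/-- Real version of utility maximization. -/
theorem IsOutcomeMap.sub_price_le (hX : IsOutcomeMap p σ X) (v : Profile E) (i : Fin n)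
    (S : Finset (E i)) (hS : p.price i S (before σ (X v) i) ≠ ⊤) :
    v i S - (p.price i S (before σ (X v) i)).toReal ≤
      v i (X v i) - (p.price i (X v i) (before σ (X v) i)).toReal := by
  have h1 := price_ne_top_of_maximizes (feasible_before (hX.feasible v) i) (hX.maximizes v i ∅)
  have h2 := hX.maximizes v i S
  rw [utility, utility] at h2
  lift p.price i S (before σ (X v) i) to NNReal using hS with a
  lift p.price i (X v i) (before σ (X v) i) to NNReal using h1 with b
  have h3 : ∀ r : NNReal, (((r : ℝ≥0∞) : EReal)) = ((r : ℝ) : EReal) := fun _ => rfl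
  rw [h3, h3, ← EReal.coe_sub, ← EReal.coe_sub, EReal.coe_le_coe_iff] at h2
  exact h2

/-- Earlier agents do not see the valuation of agent `i`, so she faces the same prices when it is
resampled. -/
theorem IsOutcomeMap.before_update (hX : IsOutcomeMap p σ X) (v : Profile E) (i : Fin n)
    (f : Finset (E i) → ℝ) :
    before σ (X (Function.update v i f)) i = before σ (X v) i :=
  before_congr fun j hj => hX.online _ _ _ fun k hk =>
    Function.update_of_ne (fun h => absurd (hk.trans_lt hj) (by simp [h])) _ _

/-- The welfare guarantee of posted prices that are balanced on average. -/
theorem IsOutcomeMap.le_integral_welfare (hX : IsOutcomeMap p σ X)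
    (hD : ∀ i, ∀ᵐ f ∂(D i), ∀ S, 0 ≤ f S ∧ f S ≤ 1) {c η : ℝ} {ρ : Alloc E → ℝ}
    (lower : ∀ x, Feasible M x →
      ENNReal.ofReal (c - ρ x) ≤ ∑ i, p.price i (x i) (before σ x i))
    (upper : ∀ x, Feasible M x → ∀ x' ∈ residual M (allocated x),
      ∑ i, p.price i (x' i) (before σ x i) ≤ ENNReal.ofReal (ρ x))
    (hρ0 : ∀ x, Feasible M x → 0 ≤ ρ x)
    (hρ : ∀ x, Feasible M x →
      2 * ρ x ≤ ∫ v, residualOpt M v (allocated x) ∂(Measure.pi D) + η) :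
    c - η ≤ ∫ v, welfare v (X v) ∂(Measure.pi D) := by
  set μ := Measure.pi D
  have : ∀ x, ∃ T : Profile E → Alloc E, (∀ z, MeasurableSet {v | T v = z}) ∧
      (Feasible M x → ∀ v, T v ∈ residual M (allocated x) ∧
        welfare v (T v) = residualOpt M v (allocated x)) := by
    intro x
    by_cases hx : Feasible M x
    · obtain ⟨T, h1, h2⟩ := exists_measurable_residual_argmax hx
      exact ⟨T, h1, fun _ => h2⟩
    · exact ⟨fun _ => x, fun _ => MeasurableSet.const _, fun h => absurd h hx⟩
  choose T hTm hT using this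
  let P : ∀ i, Finset (E i) → Alloc E → ℝ := fun i S y => (p.price i S y).toReal
  -- `U i` is the utility of agent `i`. `G i` is the net value at the prices of economy `q.1` that
  -- an independent copy `q.2` gets from its share in the residual optimum after `X q.1`.
  let U : Fin n → Profile E → ℝ := fun i v => v i (X v i) - P i (X v i) (before σ (X v) i)
  let G : Fin n → Profile E × Profile E → ℝ := fun i q =>
    q.2 i (T (X q.1) q.2 i) - P i (T (X q.1) q.2 i) (before σ (X q.1) i)
  have hUG : ∀ i (q : Profile E × Profile E),
      G i (Function.update q.1 i (q.2 i), Function.update q.2 i (q.1 i)) ≤ U i q.1 := by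
    intro i q
    simp only [G, Function.update_self]
    set x := X (Function.update q.1 i (q.2 i)) with hx
    have hxf : Feasible M x := hX.feasible _
    have hb : before σ x i = before σ (X q.1) i := hX.before_update _ _ _
    have hfin := ne_top_of_le_ne_top ENNReal.ofReal_ne_top
      (upper x hxf _ (hT x hxf (Function.update q.2 i (q.1 i))).1)
    rw [ENNReal.sum_ne_top] at hfin
    have := hfin i (Finset.mem_univ i)
    rw [hb] at this ⊢
    exact hX.sub_price_le q.1 i _ this
  have hGm : ∀ i, Integrable (G i) (μ.prod μ) := by
    intro i
    have hY : ∀ z : Alloc E × Alloc E,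
        MeasurableSet {q : Profile E × Profile E | (X q.1, T (X q.1) q.2) = z} := by
      rintro ⟨x, t⟩
      have : {q : Profile E × Profile E | (X q.1, T (X q.1) q.2) = (x, t)} =
          {v | X v = x} ×ˢ {v | T x v = t} := by
        ext q
        simp only [Prod.mk.injEq, Set.mem_ofPred_eq, Set.mem_prod]
        constructor
        · rintro ⟨rfl, h⟩; exact ⟨rfl, h⟩
        · rintro ⟨rfl, h⟩; exact ⟨rfl, h⟩
      rw [this]
      exact (hX.measurable x).prod (hTm x t)
    exact integrable_select hY (f := fun z q => q.2 i (z.2 i) - P i (z.2 i) (before σ z.1 i))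
      fun z => ((integrable_value hD i _).comp_snd μ).sub (integrable_const _)
  have hUm : ∀ i, Integrable (U i) μ := fun i =>
    integrable_select hX.measurable (f := fun z v => v i (z i) - P i (z i) (before σ z i))
      fun z => (integrable_value hD i _).sub (integrable_const _)
  have hstep : ∀ i, ∫ q, G i q ∂(μ.prod μ) ≤ ∫ v, U i v ∂μ := by
    intro i
    have hsw := measurePreserving_swap_coordinate D i
    have h1 : ∫ v, U i v ∂μ = ∫ q, U i q.1 ∂(μ.prod μ) := by
      rw [integral_fun_fst]; simp
    have h2 : ∫ q, G i q ∂(μ.prod μ) =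
        ∫ q : Profile E × Profile E,
          G i (Function.update q.1 i (q.2 i), Function.update q.2 i (q.1 i)) ∂(μ.prod μ) := by
      have := (integral_map (μ := μ.prod μ) hsw.measurable.aemeasurable (f := G i)
        (by rw [hsw.map_eq]; exact (hGm i).aestronglyMeasurable))
      rwa [hsw.map_eq] at this
    rw [h1, h2]
    exact integral_mono (hsw.integrable_comp_of_integrable (hGm i)) ((hUm i).comp_fst μ) (hUG i)
  have hGsum : ∀ q : Profile E × Profile E,
      residualOpt M q.2 (allocated (X q.1)) - ρ (X q.1) ≤ ∑ i, G i q := by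
    intro q
    have hxf := hX.feasible q.1
    obtain ⟨h1, h2⟩ := hT _ hxf q.2
    have h3 := upper _ hxf _ h1
    have hfin := ne_top_of_le_ne_top ENNReal.ofReal_ne_top h3
    have h4 := ENNReal.toReal_mono ENNReal.ofReal_ne_top h3
    rw [ENNReal.toReal_sum (ENNReal.sum_ne_top.1 hfin), ENNReal.toReal_ofReal (hρ0 _ hxf)] at h4
    rw [Finset.sum_sub_distrib, ← h2]
    exact sub_le_sub_left h4 _
  have hUsum : ∀ v, ∑ i, U i v ≤ welfare v (X v) - (c - ρ (X v)) := by
    intro v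
    have hxf := hX.feasible v
    rw [Finset.sum_sub_distrib]
    refine sub_le_sub_left ?_ _
    have h1 : ∀ i ∈ Finset.univ, p.price i (X v i) (before σ (X v) i) ≠ ⊤ := fun i _ =>
      price_ne_top_of_maximizes (feasible_before hxf i) (hX.maximizes v i ∅)
    rw [← ENNReal.toReal_sum h1]
    exact (ENNReal.ofReal_le_iff_le_toReal (ENNReal.sum_ne_top.2 h1)).1 (lower _ hxf)
  have hρm : Integrable (fun v => ρ (X v)) μ :=
    integrable_select hX.measurable (f := fun z _ => ρ z) fun z => integrable_const _
  have hWm : Integrable (fun v => welfare v (X v)) μ :=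
    integrable_select hX.measurable (f := fun z v => welfare v z) (integrable_welfare hD)
  have hRm : Integrable (fun q : Profile E × Profile E =>
      residualOpt M q.2 (allocated (X q.1))) (μ.prod μ) :=
    integrable_select (Y := fun q : Profile E × Profile E => X q.1)
      (f := fun z q => residualOpt M q.2 (allocated z))
      (fun z => measurable_fst (hX.measurable z))
      fun z => (integrable_residualOpt hD _).comp_snd μ
  have h1 : ∫ q : Profile E × Profile E,
      (residualOpt M q.2 (allocated (X q.1)) - ρ (X q.1)) ∂(μ.prod μ) ≤
      ∑ i, ∫ v, U i v ∂μ := by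
    refine (integral_mono (hRm.sub (hρm.comp_fst μ))
      (integrable_finsetSum _ fun i _ => hGm i) hGsum).trans ?_
    rw [integral_finsetSum _ fun i _ => hGm i]
    exact Finset.sum_le_sum fun i _ => hstep i
  have h2 : ∑ i, ∫ v, U i v ∂μ ≤ ∫ v, (welfare v (X v) - (c - ρ (X v))) ∂μ := by
    rw [← integral_finsetSum _ fun i _ => hUm i]
    exact integral_mono (integrable_finsetSum _ fun i _ => hUm i)
      (hWm.sub ((integrable_const c).sub hρm)) hUsum
  -- Given `X q.1`, the profile `q.2` is still distributed by `μ`, so integrating over it first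
  -- allows the use of `hρ`. The resulting expectation of `ρ (X v)` cancels the one lost in the
  -- revenue bound `hUsum`.
  have h3 : ∫ v, (ρ (X v) - η) ∂μ ≤ ∫ q : Profile E × Profile E,
      (residualOpt M q.2 (allocated (X q.1)) - ρ (X q.1)) ∂(μ.prod μ) := by
    have hint : Integrable (fun q : Profile E × Profile E =>
      residualOpt M q.2 (allocated (X q.1)) - ρ (X q.1)) (μ.prod μ) := hRm.sub (hρm.comp_fst μ)
    rw [integral_prod _ hint]
    refine integral_mono (hρm.sub (integrable_const _)) hint.integral_prod_left fun v => ?_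
    change _ ≤ ∫ v', (residualOpt M v' (allocated (X v)) - ρ (X v)) ∂μ
    rw [integral_sub (integrable_residualOpt hD _) (integrable_const _), integral_const]
    have := hρ _ (hX.feasible v)
    simp
    linarith
  have h4 : ∫ v, (welfare v (X v) - (c - ρ (X v))) ∂μ =
      ∫ v, welfare v (X v) ∂μ - (c - ∫ v, ρ (X v) ∂μ) := by
    have hint : Integrable (fun v => c - ρ (X v)) μ := (integrable_const c).sub hρm
    rw [integral_sub hWm hint,
      integral_sub (integrable_const c) hρm, integral_const]
    simp
  have h5 : ∫ v, (ρ (X v) - η) ∂μ = ∫ v, ρ (X v) ∂μ - η := by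
    rw [integral_sub hρm (integrable_const η), integral_const]
    simp
  linarith

end Mechanism

/-! ### Averaged prices and the factor 1/2 -/

section AveragePrices

variable {n : ℕ} {E : Fin n → Type u} [∀ i, DecidableEq (E i)] [∀ i, Fintype (E i)]

/-- Bounded real prices `q` that are balanced for the residual optima `ρ`. -/
structure IsPriceSystem (M : Matroid (Σ i, E i)) (ρ : Alloc E → ℝ)
    (q : ∀ i, Finset (E i) → Alloc E → ℝ) : Prop where
  mem_Icc : (ρ, q) ∈ Set.Icc (0 : (Alloc E → ℝ) × (∀ i, Finset (E i) → Alloc E → ℝ))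
    (fun _ => (n : ℝ), fun _ _ _ => (n : ℝ))
  null : ∀ i y, q i ∅ y = 0
  lower : ∀ (σ : Equiv.Perm (Fin n)) (x : Alloc E), Feasible M x →
    ρ (fun _ => ∅) - ρ x ≤ ∑ i, q i (x i) (before σ x i)
  upper : ∀ (σ : Equiv.Perm (Fin n)) (x : Alloc E), Feasible M x →
    ∀ x' ∈ residual M (allocated x), ∑ i, q i (x' i) (before σ x i) ≤ ρ x

variable (M : Matroid (Σ i, E i))

/-- The set is the projection of a compact set of pairs `(ρ, q)`; compactness is the reason for the
bound `n` in `IsPriceSystem`. Closedness allows prices to be averaged without a measurable choice of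
supporting weights. -/
theorem isClosed_exists_isPriceSystem : IsClosed {ρ | ∃ q, IsPriceSystem M ρ q} := by
  have hK : IsCompact {z : (Alloc E → ℝ) × (∀ i, Finset (E i) → Alloc E → ℝ) |
      IsPriceSystem M z.1 z.2} := by
    have hrw : {z : (Alloc E → ℝ) × (∀ i, Finset (E i) → Alloc E → ℝ) |
        IsPriceSystem M z.1 z.2} =
        Set.Icc (0 : (Alloc E → ℝ) × (∀ i, Finset (E i) → Alloc E → ℝ))
          (fun _ => (n : ℝ), fun _ _ _ => (n : ℝ)) ∩
        ({z | ∀ i y, z.2 i ∅ y = 0} ∩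
        ({z | ∀ (σ : Equiv.Perm (Fin n)) (x : Alloc E), Feasible M x →
          z.1 (fun _ => ∅) - z.1 x ≤ ∑ i, z.2 i (x i) (before σ x i)} ∩
        {z | ∀ (σ : Equiv.Perm (Fin n)) (x : Alloc E), Feasible M x →
          ∀ x' ∈ residual M (allocated x), ∑ i, z.2 i (x' i) (before σ x i) ≤ z.1 x})) := by
      ext z
      exact ⟨fun h => ⟨h.1, h.2, h.3, h.4⟩, fun h => ⟨h.1, h.2.1, h.2.2.1, h.2.2.2⟩⟩
    rw [hrw]
    refine isCompact_Icc.inter_right (IsClosed.inter ?_ (IsClosed.inter ?_ ?_)) <;>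
      simp only [Set.ofPred_forall]
    · refine isClosed_iInter fun i => isClosed_iInter fun y => isClosed_eq ?_ ?_ <;> fun_prop
    · refine isClosed_iInter fun σ => isClosed_iInter fun x => isClosed_iInter fun _ =>
        isClosed_le ?_ ?_ <;> fun_prop
    · refine isClosed_iInter fun σ => isClosed_iInter fun x => isClosed_iInter fun _ =>
        isClosed_iInter fun x' => isClosed_iInter fun _ => isClosed_le ?_ ?_ <;> fun_prop
  convert (hK.image continuous_fst).isClosed using 1
  ext ρ
  simp

theorem convex_exists_isPriceSystem : Convex ℝ {ρ | ∃ q, IsPriceSystem M ρ q} := by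
  rintro ρ₁ ⟨q₁, h₁⟩ ρ₂ ⟨q₂, h₂⟩ a b ha hb hab
  refine ⟨a • q₁ + b • q₂, ?_, fun i y => ?_, fun σ x hx => ?_, fun σ x hx x' hx' => ?_⟩
  · exact convex_Icc _ _ h₁.mem_Icc h₂.mem_Icc ha hb hab
  · simp [h₁.null, h₂.null]
  · have h3 := mul_le_mul_of_nonneg_left (h₁.lower σ x hx) ha
    have h4 := mul_le_mul_of_nonneg_left (h₂.lower σ x hx) hb
    simp only [Pi.add_apply, Pi.smul_apply, smul_eq_mul, Finset.sum_add_distrib,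
      ← Finset.mul_sum]
    linarith
  · have h3 := mul_le_mul_of_nonneg_left (h₁.upper σ x hx x' hx') ha
    have h4 := mul_le_mul_of_nonneg_left (h₂.upper σ x hx x' hx') hb
    simp only [Pi.add_apply, Pi.smul_apply, smul_eq_mul, Finset.sum_add_distrib,
      ← Finset.mul_sum]
    linarith

variable {M}

theorem exists_isPriceSystem_of_profile {v : Profile E}
    (hv : ∀ i, IsAdditive (v i) ∨ IsSubmodular (v i) ∨ IsXOS (v i))
    (hv01 : ∀ i S, 0 ≤ v i S ∧ v i S ≤ 1) :
    ∃ q, IsPriceSystem M (fun x => residualOpt M v (allocated x)) q := by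
  obtain ⟨z, hz, hzw⟩ := exists_welfare_eq_residualOpt (M := M) (S := ∅) v (by simp)
  rw [residual_empty] at hz
  obtain ⟨a, ha⟩ := exists_supports hv z
  have hbal := fun σ => isBalanced_of_supports (M := M) (ALG := fun _ => z) hz ha σ
  have hR0 : ∀ S, 0 ≤ residualOpt M v S := residualOpt_nonneg fun i S => (hv01 i S).1
  have hRa0 : ∀ S, 0 ≤ residualOpt M (additiveProfile a) S :=
    residualOpt_nonneg fun i S => Finset.sum_nonneg fun j _ => ha.nonneg i j
  have hRn : ∀ S, residualOpt M v S ≤ n := residualOpt_le fun i S => (hv01 i S).2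
  -- `toReal` turns the price `⊤` into 0. The inequalities involve only outcomes with finite prices,
  -- and `halfPricing` restores `⊤` at infeasible outcomes.
  refine ⟨fun i S y => ((matroidPricing M (additiveProfile a)).price i S y).toReal,
    ⟨⟨fun x => hR0 _, fun i S y => ENNReal.toReal_nonneg⟩, fun x => hRn _, fun i S y => ?_⟩,
    fun i y => ?_, fun σ x hx => ?_, fun σ x hx x' hx' => ?_⟩
  · by_cases h : M.Indep ((allocated y ∪ bundle i S : Finset _) : Set (Σ i, E i))
    · simp only [matroidPricing_price_of_indep _ h]
      refine ENNReal.toReal_le_of_le_ofReal n.cast_nonneg (ENNReal.ofReal_le_ofReal ?_)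
      have := residualOpt_mono (M := M) ha.le (allocated y)
      linarith [hRa0 (allocated y ∪ bundle i S), hRn (allocated y)]
    · have : (matroidPricing M (additiveProfile a)).price i S y = ⊤ := if_neg h
      simp [this]
  · by_cases h : Feasible M y
    · simp [(matroidPricing M _).null i y h]
    · have : (matroidPricing M (additiveProfile a)).price i ∅ y = ⊤ :=
        if_neg (by simpa [bundle, Feasible] using h)
      simp [this]
  · have h1 := (hbal σ).lower x hx
    have hfin := ENNReal.sum_ne_top.1 (ne_of_eq_of_ne (sum_price_eq (additiveProfile a) σ hx)
      ENNReal.ofReal_ne_top)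
    rw [ENNReal.ofReal_le_iff_le_toReal (ENNReal.sum_ne_top.2 hfin), ENNReal.toReal_sum hfin] at h1
    simp only [allocated_empty, ← hzw]
    change 1 / 1 * (welfare v z - residualOpt M v (allocated x)) ≤ _ at h1
    rwa [one_div_one, one_mul] at h1
  · have h1 := (hbal σ).upper x hx x' hx'
    have hfin := ENNReal.sum_ne_top.1 (ne_top_of_le_ne_top ENNReal.ofReal_ne_top h1)
    rw [← ENNReal.toReal_sum hfin]
    refine ENNReal.toReal_le_of_le_ofReal (hR0 _) (h1.trans (ENNReal.ofReal_le_ofReal ?_))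
    rw [one_mul]
    rfl

variable {D : ∀ i, Measure (Finset (E i) → ℝ)} [∀ i, IsProbabilityMeasure (D i)]

/-- The expected residual optima admit balanced prices, since the set of all functions that do so is
convex and closed. -/
theorem exists_isPriceSystem_integral
    (hD : ∀ i, ∀ᵐ f ∂(D i), (IsAdditive f ∨ IsSubmodular f ∨ IsXOS f) ∧ ∀ S, 0 ≤ f S ∧ f S ≤ 1) :
    ∃ q, IsPriceSystem M (fun x => ∫ v, residualOpt M v (allocated x) ∂(Measure.pi D)) q := by
  have hD' : ∀ i, ∀ᵐ f ∂(D i), ∀ S, 0 ≤ f S ∧ f S ≤ 1 := fun i => (hD i).mono fun f hf => hf.2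
  have hint : ∀ x : Alloc E, Integrable (fun v => residualOpt M v (allocated x)) (Measure.pi D) :=
    fun x => integrable_residualOpt hD' _
  have := (convex_exists_isPriceSystem M).integral_mem (μ := Measure.pi D)
    (f := fun v x => residualOpt M v (allocated x)) (isClosed_exists_isPriceSystem M) (by
      filter_upwards [ae_pi_of_ae hD] with v hv
      exact exists_isPriceSystem_of_profile (fun i => (hv i).1) fun i => (hv i).2)
    (Integrable.of_eval hint)
  have heq : (∫ v, fun x => residualOpt M v (allocated x) ∂(Measure.pi D)) =
      fun x => ∫ v, residualOpt M v (allocated x) ∂(Measure.pi D) := by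
    ext x
    exact eval_integral hint x
  rwa [heq] at this

open Classical in
/-- Half of the prices `q`, with price `∞` for infeasible outcomes. -/
noncomputable def halfPricing (M : Matroid (Σ i, E i)) (q : ∀ i, Finset (E i) → Alloc E → ℝ)
    (hq : ∀ i y, q i ∅ y = 0) : PricingRule M where
  price i S y := if Feasible M (Function.update y i S) then ENNReal.ofReal (q i S y / 2) else ⊤
  infeasible i S y h := if_neg h
  null i y h := by
    rw [if_pos]
    · simp [hq]
    · refine h.subset ?_
      rintro ⟨j, e⟩ he
      by_cases hj : j = i
      · subst hj; simp at he
      · simpa [hj] using he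

theorem feasible_update_before {x : Alloc E} {i : Fin n} {S : Finset (E i)}
    (h : Feasible M (Function.update x i S)) (σ : Equiv.Perm (Fin n)) :
    Feasible M (Function.update (before σ x i) i S) := by
  refine h.subset ?_
  rintro ⟨j, e⟩ he
  by_cases hj : j = i
  · subst hj; simpa using he
  · simp only [Finset.mem_coe, mem_allocated, Function.update_of_ne hj, before] at he ⊢
    split_ifs at he
    · exact he
    · simp at he

theorem sum_halfPricing {q : ∀ i, Finset (E i) → Alloc E → ℝ} (hq : ∀ i y, q i ∅ y = 0)
    (hq0 : ∀ i S y, 0 ≤ q i S y) {σ : Equiv.Perm (Fin n)} {x x' : Alloc E}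
    (h : ∀ i, Feasible M (Function.update x i (x' i))) :
    ∑ i, (halfPricing M q hq).price i (x' i) (before σ x i) =
      ENNReal.ofReal ((∑ i, q i (x' i) (before σ x i)) / 2) := by
  rw [Finset.sum_div, ENNReal.ofReal_sum_of_nonneg fun i _ => div_nonneg (hq0 _ _ _) two_pos.le]
  exact Finset.sum_congr rfl fun i _ => if_pos (feasible_update_before (h i) σ)

theorem exists_half_approximation
    (hD : ∀ i, ∀ᵐ f ∂(D i), (IsAdditive f ∨ IsSubmodular f ∨ IsXOS f) ∧ ∀ S, 0 ≤ f S ∧ f S ≤ 1) :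
    ∃ p : PricingRule M, ∀ (σ : Equiv.Perm (Fin n)) (X : Profile E → Alloc E),
      IsOutcomeMap p σ X →
        1 / 2 * ∫ v, optWelfare v {x | Feasible M x} ∂(Measure.pi D) ≤
          ∫ v, welfare v (X v) ∂(Measure.pi D) := by
  have hD' : ∀ i, ∀ᵐ f ∂(D i), ∀ S, 0 ≤ f S ∧ f S ≤ 1 := fun i => (hD i).mono fun f hf => hf.2
  obtain ⟨q, hq⟩ := exists_isPriceSystem_integral (M := M) hD
  have hq0 : ∀ i S y, 0 ≤ q i S y := hq.mem_Icc.1.2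
  refine ⟨halfPricing M q hq.null, fun σ X hX => ?_⟩
  -- With half of the balanced prices, `ρ` is half of the expected residual optimum, so `hρ` holds
  -- with equality and `η = 0`.
  have := hX.le_integral_welfare hD'
    (c := 1 / 2 * ∫ v, residualOpt M v ∅ ∂(Measure.pi D)) (η := 0)
    (ρ := fun x => (∫ v, residualOpt M v (allocated x) ∂(Measure.pi D)) / 2)
    (fun x hx => by
      rw [sum_halfPricing _ hq0 fun i => by rwa [Function.update_eq_self]]
      refine ENNReal.ofReal_le_ofReal ?_
      have := hq.lower σ x hx
      simp only [allocated_empty] at this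
      linarith)
    (fun x hx x' hx' => by
      rw [sum_halfPricing _ hq0 fun i => exchangeCompatible_residual M x x' hx' i]
      refine ENNReal.ofReal_le_ofReal ?_
      have := hq.upper σ x hx x' hx'
      linarith)
    (fun x hx => div_nonneg (hq.mem_Icc.1.1 x) two_pos.le)
    (fun x hx => by linarith)
  simp only [← residual_empty (M := M)]
  simpa [residualOpt] using this

end AveragePrices

/-! ### Concentration and the factor 1/4 -/

section Sampling

open ProbabilityTheory in
/-- Hoeffding's inequality for the empirical mean of a bounded function. -/
theorem measure_average_deviation_le {Ω : Type*} [MeasurableSpace Ω] (μ : Measure Ω)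
    [IsProbabilityMeasure μ] {f : Ω → ℝ} (hf : Measurable f) {B : ℝ} (hB : 0 < B)
    (hfB : ∀ᵐ ω ∂μ, f ω ∈ Set.Icc 0 B) (N : ℕ) [NeZero N] {η : ℝ} (hη : 0 ≤ η) :
    (Measure.pi fun _ : Fin N => μ) {w | ¬ |(N : ℝ)⁻¹ * ∑ t, f (w t) - ∫ ω, f ω ∂μ| ≤ η} ≤
      ENNReal.ofReal (2 * Real.exp (-(2 * N * η ^ 2 / B ^ 2))) := by
  set P := Measure.pi fun _ : Fin N => μ
  have hN : (0 : ℝ) < N := by exact_mod_cast Nat.pos_of_ne_zero (NeZero.ne N)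
  set m := ∫ ω, f ω ∂μ
  have hsub := hasSubgaussianMGF_of_mem_Icc hf.aemeasurable hfB
  have hsubt : ∀ t : Fin N,
      HasSubgaussianMGF (fun w : Fin N → Ω => f (w t) - m) ((‖B - 0‖₊ / 2) ^ 2) P := by
    intro t
    have hmp := measurePreserving_eval (fun _ : Fin N => μ) t
    exact HasSubgaussianMGF.of_map (Y := Function.eval t) hmp.measurable.aemeasurable
      (by rw [hmp.map_eq]; exact hsub)
  have hind : iIndepFun (fun (t : Fin N) (w : Fin N → Ω) => f (w t) - m) P :=
    iIndepFun_pi (μ := fun _ : Fin N => μ) (X := fun _ ω => f ω - m)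
      fun _ => (hf.sub_const m).aemeasurable
  have hind' : iIndepFun (fun (t : Fin N) (w : Fin N → Ω) => -(f (w t) - m)) P :=
    iIndepFun_pi (μ := fun _ : Fin N => μ) (X := fun _ ω => -(f ω - m))
      fun _ => (hf.sub_const m).neg.aemeasurable
  have h1 := HasSubgaussianMGF.measure_sum_ge_le_of_iIndepFun hind (s := Finset.univ) (fun t _ => hsubt t)
    (ε := N * η) (by positivity)
  have h2 := HasSubgaussianMGF.measure_sum_ge_le_of_iIndepFun hind' (s := Finset.univ) (fun t _ => (hsubt t).neg)
    (ε := N * η) (by positivity)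
  -- A variable with values in `[0, B]` is sub-Gaussian with variance proxy `B ^ 2 / 4`, and the
  -- proxies of the `N` independent samples add up.
  have hexp : -(N * η) ^ 2 / (2 * ((∑ _t : Fin N, (‖B - 0‖₊ / 2) ^ 2 : NNReal) : ℝ)) =
      -(2 * N * η ^ 2 / B ^ 2) := by
    simp only [sub_zero, Finset.sum_const, Finset.card_univ, Fintype.card_fin, nsmul_eq_mul]
    push_cast
    rw [Real.norm_of_nonneg hB.le]
    field_simp
  rw [hexp] at h1 h2
  have hsum : ∀ w : Fin N → Ω, ∑ t, (f (w t) - m) = N * ((N : ℝ)⁻¹ * ∑ t, f (w t) - m) := by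
    intro w
    rw [Finset.sum_sub_distrib, mul_sub, ← mul_assoc, mul_inv_cancel₀ hN.ne']
    simp
  calc P {w | ¬ |(N : ℝ)⁻¹ * ∑ t, f (w t) - m| ≤ η}
      ≤ P ({w | N * η ≤ ∑ t, (f (w t) - m)} ∪ {w | N * η ≤ ∑ t, -(f (w t) - m)}) := by
        refine measure_mono fun w hw => ?_
        simp only [Set.mem_union, Set.mem_ofPred_eq, Finset.sum_neg_distrib, hsum] at hw ⊢
        rw [not_le, lt_abs] at hw
        refine hw.imp (fun h => mul_le_mul_of_nonneg_left h.le hN.le) fun h => ?_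
        rw [← mul_neg]
        exact mul_le_mul_of_nonneg_left h.le hN.le
    _ ≤ P {w | N * η ≤ ∑ t, (f (w t) - m)} + P {w | N * η ≤ ∑ t, -(f (w t) - m)} :=
        measure_union_le _ _
    _ ≤ ENNReal.ofReal (Real.exp (-(2 * N * η ^ 2 / B ^ 2))) +
          ENNReal.ofReal (Real.exp (-(2 * N * η ^ 2 / B ^ 2))) := by
        refine add_le_add ?_ ?_
        · rw [← ofReal_measureReal]; exact ENNReal.ofReal_le_ofReal h1
        · rw [← ofReal_measureReal]; exact ENNReal.ofReal_le_ofReal h2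
    _ = _ := by rw [← ENNReal.ofReal_add (by positivity) (by positivity), ← two_mul]

variable {n : ℕ} {E : Fin n → Type u} [∀ i, DecidableEq (E i)] [∀ i, Fintype (E i)]
  {M : Matroid (Σ i, E i)} {D : ∀ i, Measure (Finset (E i) → ℝ)} [∀ i, IsProbabilityMeasure (D i)]

theorem half_average_ofReal (N : ℕ) [NeZero N] {c : Fin N → ℝ} (hc : ∀ t, 0 ≤ c t) :
    2⁻¹ * ((N : ℝ≥0∞)⁻¹ * ∑ t, ENNReal.ofReal (c t)) =
      ENNReal.ofReal (1 / 2 * ((N : ℝ)⁻¹ * ∑ t, c t)) := by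
  have hN : (0 : ℝ) < N := by exact_mod_cast Nat.pos_of_ne_zero (NeZero.ne N)
  rw [ENNReal.ofReal_mul (by norm_num), ENNReal.ofReal_mul (by positivity),
    ENNReal.ofReal_sum_of_nonneg fun t _ => hc t, ENNReal.ofReal_inv_of_pos hN,
    ENNReal.ofReal_natCast, one_div, ENNReal.ofReal_inv_of_pos two_pos, ENNReal.ofReal_ofNat]

theorem sum_averagePricing {N : ℕ} [NeZero N] (b : Fin N → Weights E)
    (S : Alloc E) (y : Fin n → Alloc E) :
    ∑ i, (averagePricing M b).price i (S i) (y i) =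
      2⁻¹ * ((N : ℝ≥0∞)⁻¹ *
        ∑ t, ∑ i, (matroidPricing M (additiveProfile (b t))).price i (S i) (y i)) := by
  simp only [averagePricing]
  rw [← Finset.mul_sum, ← Finset.mul_sum, Finset.sum_comm]

/-- Greedy prices that are averaged over samples give a quarter of the optimal welfare if the
empirical means of all residual optima are accurate. -/
theorem IsOutcomeMap.le_integral_welfare_of_samples
    (hD : ∀ i, ∀ᵐ f ∂(D i), ∀ S, 0 ≤ f S ∧ f S ≤ 1) {N : ℕ} [NeZero N] {w : Fin N → Profile E}
    (hw : ∀ t i, IsSubmodular (w t i)) {η : ℝ}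
    (hη : ∀ S, |(N : ℝ)⁻¹ * ∑ t, residualOpt M (w t) S -
      ∫ v, residualOpt M v S ∂(Measure.pi D)| ≤ η)
    {σ : Equiv.Perm (Fin n)} {X : Profile E → Alloc E}
    (hX : IsOutcomeMap (averagePricing M fun t => greedyWeights M (w t)) σ X) :
    1 / 4 * ∫ v, residualOpt M v ∅ ∂(Measure.pi D) - 5 / 4 * η ≤
      ∫ v, welfare v (X v) ∂(Measure.pi D) := by
  have hN : (0 : ℝ) ≤ (N : ℝ)⁻¹ := by positivity
  choose g hg hgs using fun t => exists_isGreedyOutput_supports M (hw t)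
  have hRa0 : ∀ t S, 0 ≤ residualOpt M (additiveProfile (greedyWeights M (w t))) S := fun t =>
    residualOpt_nonneg fun i S => Finset.sum_nonneg fun j _ => (hgs t).nonneg i j
  have hR0 : ∀ t S, 0 ≤ residualOpt M (w t) S := fun t =>
    residualOpt_nonneg fun i S => (hw t i).nonneg S
  have hmono : ∀ t S, residualOpt M (additiveProfile (greedyWeights M (w t))) S ≤
      residualOpt M (w t) S := fun t => residualOpt_mono (hgs t).le
  have hhalf : ∀ t, 1 / 2 * residualOpt M (w t) ∅ ≤
      residualOpt M (additiveProfile (greedyWeights M (w t))) ∅ := by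
    intro t
    have h1 := residualOpt_empty_le_two_mul (hw t) (hg t)
    have h2 : welfare (w t) (g t) = welfare (additiveProfile (greedyWeights M (w t))) (g t) :=
      Finset.sum_congr rfl fun i _ => ((hgs t).eq i).symm
    have h3 := welfare_le_residualOpt (M := M) (S := ∅)
      (additiveProfile (greedyWeights M (w t))) (t := g t) (by
        rw [residual_empty]; exact GreedyStep.feasible_of_reflTransGen (hg t).1)
    linarith
  -- The greedy prices of a sample sum to at least half of its optimum minus its residual optimum;
  -- halving the prices gives 1/4 in `c` and 1/2 in `ρ`. The sampling error enters as `η` through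
  -- `ρ` and as `η / 4` through `c`.
  have key := hX.le_integral_welfare hD (η := η)
    (c := 1 / 4 * ((N : ℝ)⁻¹ * ∑ t, residualOpt M (w t) ∅))
    (ρ := fun x => 1 / 2 * ((N : ℝ)⁻¹ * ∑ t, residualOpt M (w t) (allocated x)))
    (fun x hx => by
      simp only [sum_averagePricing, sum_price_eq _ σ hx]
      rw [half_average_ofReal N fun t => sub_nonneg.2 (residualOpt_anti M _
        (Finset.empty_subset _) hx)]
      refine ENNReal.ofReal_le_ofReal ?_
      have : (N : ℝ)⁻¹ * ∑ t, (1 / 2 * residualOpt M (w t) ∅ -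
          residualOpt M (w t) (allocated x)) ≤ (N : ℝ)⁻¹ *
          ∑ t, (residualOpt M (additiveProfile (greedyWeights M (w t))) ∅ -
            residualOpt M (additiveProfile (greedyWeights M (w t))) (allocated x)) :=
        mul_le_mul_of_nonneg_left (Finset.sum_le_sum fun t _ =>
          sub_le_sub (hhalf t) (hmono t _)) hN
      rw [Finset.sum_sub_distrib, ← Finset.mul_sum] at this
      linarith)
    (fun x hx x' hx' => by
      simp only [sum_averagePricing]
      rw [← half_average_ofReal N fun t => hR0 t _]
      gcongr with t
      exact (sum_price_le (hgs t).nonneg σ hx').trans (ENNReal.ofReal_le_ofReal (hmono t _)))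
    (fun x hx => mul_nonneg (by norm_num) (mul_nonneg hN (Finset.sum_nonneg fun t _ => hR0 t _)))
    (fun x hx => by
      have := (abs_le.1 (hη (allocated x))).2
      linarith)
  have := (abs_le.1 (hη ∅)).1
  linarith

/-- Accuracy of the empirical residual optimum at every `S` suffices for all orders and
tie-breakings at once, so a union bound over the subsets of the ground set is enough. The two
Hoeffding tails give the extra factor 2, and the range bound `n + 1` stays positive when `n = 0`. -/
theorem measure_samples_le (hD : ∀ i, ∀ᵐ f ∂(D i), IsSubmodular f ∧ ∀ S, 0 ≤ f S ∧ f S ≤ 1)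
    (N : ℕ) [NeZero N] {η : ℝ} (hη : 0 ≤ η) :
    (Measure.pi fun _ : Fin N => Measure.pi D)
      {w | ¬ ∀ (σ : Equiv.Perm (Fin n)) (X : Profile E → Alloc E),
        IsOutcomeMap (averagePricing M fun t => greedyWeights M (w t)) σ X →
          1 / 4 * ∫ v, residualOpt M v ∅ ∂(Measure.pi D) - 5 / 4 * η ≤
            ∫ v, welfare v (X v) ∂(Measure.pi D)} ≤
      ENNReal.ofReal (2 ^ (Fintype.card (Σ i, E i) + 1) *
        Real.exp (-(2 * N * η ^ 2 / (n + 1) ^ 2))) := by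
  have hD' : ∀ i, ∀ᵐ f ∂(D i), ∀ S, 0 ≤ f S ∧ f S ≤ 1 := fun i => (hD i).mono fun f hf => hf.2
  set P := Measure.pi fun _ : Fin N => Measure.pi D
  have hsub : ∀ᵐ w ∂P, ∀ t i, IsSubmodular (w t i) :=
    ae_all_iff.2 fun t => (Measure.tendsto_eval_ae_ae (μ := fun _ : Fin N => Measure.pi D)
      (i := t)).eventually ((ae_pi_of_ae hD).mono fun v hv i => (hv i).1)
  let bad : Finset (Σ i, E i) → Set (Fin N → Profile E) := fun S =>
    {w | ¬ |(N : ℝ)⁻¹ * ∑ t, residualOpt M (w t) S - ∫ v, residualOpt M v S ∂(Measure.pi D)| ≤ η}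
  calc _ ≤ P (⋃ S, bad S) := by
        refine measure_mono_ae ?_
        filter_upwards [hsub] with w hw hbad
        by_contra h
        refine hbad fun σ X hX => hX.le_integral_welfare_of_samples hD' hw fun S => ?_
        by_contra hS
        exact h (Set.mem_iUnion.2 ⟨S, hS⟩)
    _ ≤ ∑ S, P (bad S) := measure_iUnion_fintype_le _ _
    _ ≤ ∑ _S : Finset (Σ i, E i),
          ENNReal.ofReal (2 * Real.exp (-(2 * N * η ^ 2 / (n + 1) ^ 2))) := by
        refine Finset.sum_le_sum fun S _ => measure_average_deviation_le (Measure.pi D)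
          (measurable_residualOpt S) (by positivity) ?_ N hη
        filter_upwards [ae_residualOpt_mem_Icc (M := M) hD'] with v hv
        exact ⟨(hv S).1, (hv S).2.trans (by simp)⟩
    _ = _ := by
        rw [Finset.sum_const, Finset.card_univ, Fintype.card_finset, nsmul_eq_mul,
          ← ENNReal.ofReal_natCast, ← ENNReal.ofReal_mul (by positivity)]
        push_cast
        congr 1
        ring

theorem two_pow_mul_exp_le {c : ℕ} {b δ s : ℝ} (hδ : 0 < δ)
    (hb : 1 + c + Real.log (1 / δ) ≤ b) (hs : b ≤ s) :
    2 ^ (c + 1) * Real.exp (-s) ≤ δ := by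
  have h2 : (2 : ℝ) ≤ Real.exp 1 := by linarith [Real.add_one_le_exp 1]
  have h3 : (2 : ℝ) ^ (c + 1) ≤ Real.exp (c + 1) := by
    have := pow_le_pow_left₀ (by norm_num) h2 (c + 1)
    rw [← Real.exp_nat_mul] at this
    simpa using this
  have h4 : Real.exp (-s) ≤ Real.exp (-(c + 1)) * δ := by
    rw [show Real.exp (-(c + 1)) * δ = Real.exp (-(c + 1)) * Real.exp (Real.log δ) by
      rw [Real.exp_log hδ], ← Real.exp_add]
    refine Real.exp_le_exp.2 ?_
    rw [one_div, Real.log_inv] at hb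
    linarith
  calc 2 ^ (c + 1) * Real.exp (-s) ≤ Real.exp (c + 1) * (Real.exp (-(c + 1)) * δ) := by gcongr
    _ = δ := by rw [← mul_assoc, ← Real.exp_add]; simp

end Sampling

end MatroidPricing

/-! ### The main theorem -/

open MatroidPricing in
theorem theorem1p4 :
    (∀ (n : ℕ) (E : Fin n → Type u) [∀ i, Fintype (E i)] [∀ i, DecidableEq (E i)]
        (M : Matroid (Σ i, E i)), M.E = Set.univ →
      -- additive valuations: the prices are (1,1)-balanced, for every order of the agents
      (∀ w : Weights E, (∀ i j, 0 ≤ w i j) → ∀ OPT, IsOptimalRule M OPT →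
        ∀ σ : Equiv.Perm (Fin n),
          IsBalanced M (additiveProfile w) (matroidPricing M (additiveProfile w)) 1 1 OPT
            (fun x => residual M (allocated x)) σ) ∧
      -- additive, submodular, XOS valuations: the prices of a supporting additive profile
      (∀ v : Profile E, (∀ i, IsAdditive (v i) ∨ IsSubmodular (v i) ∨ IsXOS (v i)) →
        ∀ OPT, IsOptimalRule M OPT →
          (∃ a, Supports a v (OPT v)) ∧
          ∀ a, Supports a v (OPT v) → ∀ σ : Equiv.Perm (Fin n),
            IsBalanced M v (matroidPricing M (additiveProfile a)) 1 1 OPT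
              (fun x => residual M (allocated x)) σ) ∧
      -- existence of an order-oblivious 2-approximate mechanism
      (∀ (D : ∀ i, Measure (Finset (E i) → ℝ)) [∀ i, IsProbabilityMeasure (D i)],
        (∀ i, ∀ᵐ f ∂(D i), (IsAdditive f ∨ IsSubmodular f ∨ IsXOS f) ∧
          ∀ S, 0 ≤ f S ∧ f S ≤ 1) →
        ∃ p : PricingRule M, ∀ (σ : Equiv.Perm (Fin n)) (X : Profile E → Alloc E),
          IsOutcomeMap p σ X →
            1 / 2 * ∫ v, optWelfare v {x | Feasible M x} ∂(Measure.pi D) ≤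
              ∫ v, welfare v (X v) ∂(Measure.pi D)) ∧
      -- prices that are based on the greedy algorithm are (1,1)-balanced with respect to it
      (∀ v : Profile E, (∀ i, IsAdditive (v i) ∨ IsSubmodular (v i) ∨ IsXOS (v i)) →
        ∀ GRD : Profile E → Alloc E, (∀ u, IsGreedyOutput M u (GRD u)) →
          (∃ a, Supports a v (GRD v)) ∧
          ∀ a, Supports a v (GRD v) → ∀ σ : Equiv.Perm (Fin n),
            IsBalanced M v (matroidPricing M (additiveProfile a)) 1 1 GRD
              (fun x => residual M (allocated x)) σ)) ∧
    -- submodular valuations: sampled greedy prices, computed with polynomially many value queries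
    ∃ (C : ℝ) (k : ℕ), ∀ (n : ℕ) (E : Fin n → Type u) [∀ i, Fintype (E i)]
        [∀ i, DecidableEq (E i)] (M : Matroid (Σ i, E i)), M.E = Set.univ →
      ∀ ε δ : ℝ, 0 < ε → 0 < δ → δ < 1 →
        ∃ (N : ℕ) (alg : ValueQueryAlg N E (PricingRule M)) (a : Profile E → Weights E),
          (N : ℝ) ≤ C * (1 + n + Fintype.card (Σ i, E i) + 1 / ε + Real.log (1 / δ)) ^ k ∧
          (∀ w, (alg.numQueries w : ℝ) ≤
            C * (1 + n + Fintype.card (Σ i, E i) + 1 / ε + Real.log (1 / δ)) ^ k) ∧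
          (∀ v : Profile E, (∀ i, IsSubmodular (v i)) →
            ∃ g, IsGreedyOutput M v g ∧ Supports (a v) v g) ∧
          (∀ w i S y, (alg.run w).price i S y =
            2⁻¹ * ((N : ℝ≥0∞)⁻¹ *
              ∑ t, (matroidPricing M (additiveProfile (a (w t)))).price i S y)) ∧
          ∀ (D : ∀ i, Measure (Finset (E i) → ℝ)) [∀ i, IsProbabilityMeasure (D i)],
            (∀ i, ∀ᵐ f ∂(D i), IsSubmodular f ∧ ∀ S, 0 ≤ f S ∧ f S ≤ 1) →
            (Measure.pi fun _ : Fin N => Measure.pi D)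
              {w | ¬ ∀ (σ : Equiv.Perm (Fin n)) (X : Profile E → Alloc E),
                IsOutcomeMap (alg.run w) σ X →
                  1 / 4 * ∫ v, optWelfare v {x | Feasible M x} ∂(Measure.pi D) - ε ≤
                    ∫ v, welfare v (X v) ∂(Measure.pi D)} ≤ ENNReal.ofReal δ := by
  refine ⟨fun n E _ _ M _ => ⟨fun w hw OPT hOPT σ => ?_, fun v hv OPT hOPT => ⟨?_, ?_⟩,
    fun D _ hD => exists_half_approximation hD, fun v hv GRD hGRD => ⟨?_, ?_⟩⟩, 6, 7,
    fun n E _ _ M _ ε δ hε hδ hδ1 => ?_⟩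
  · exact isBalanced_of_supports (hOPT _).1 ⟨hw, fun _ _ => le_rfl, fun _ => rfl⟩ σ
  · exact exists_supports hv _
  · exact fun a ha σ => isBalanced_of_supports (hOPT v).1 ha σ
  · exact exists_supports hv _
  · exact fun a ha σ =>
      isBalanced_of_supports (GreedyStep.feasible_of_reflTransGen (hGRD v).1) ha σ
  set c := Fintype.card (Σ i, E i)
  have hlog : 0 < Real.log (1 / δ) := Real.log_pos (by rw [lt_div_iff₀ hδ]; linarith)
  have hε' : 0 < 1 / ε := by positivity
  set b : ℝ := 1 + n + c + 1 / ε + Real.log (1 / δ) with hb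
  have hn0 : (0 : ℝ) ≤ n := n.cast_nonneg
  have hc0 : (0 : ℝ) ≤ c := c.cast_nonneg
  have hb1 : 1 ≤ b := by linarith
  -- With `η = ε / 2` the Hoeffding exponent is `N * ε ^ 2 / (2 * (n + 1) ^ 2)`, and it has to reach
  -- `b`. Since `n + 1 ≤ b` and `1 / ε ≤ b`, the choice `N ≥ 2 * b ^ 5` suffices. Each sample costs
  -- `(c + 1) * (2 * c) ≤ 2 * b ^ 2` queries, and with `N ≤ 3 * b ^ 5` this gives the polynomial `6
  -- * b ^ 7`.
  set N := ⌈2 * b ^ 5⌉₊ with hN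
  have hNlow : 2 * b ^ 5 ≤ N := Nat.le_ceil _
  have hNup : (N : ℝ) ≤ 3 * b ^ 5 := by
    have := (Nat.ceil_lt_add_one (show (0 : ℝ) ≤ 2 * b ^ 5 by positivity)).le
    have : (1 : ℝ) ≤ b ^ 5 := one_le_pow₀ hb1
    linarith
  have : NeZero N := ⟨(Nat.ceil_pos.2 (by positivity)).ne'⟩
  have hb57 : b ^ 5 ≤ b ^ 7 := pow_le_pow_right₀ hb1 (by norm_num)
  refine ⟨N, sampleAlg N M, greedyWeights M, ?_, fun w => ?_,
    fun v hv => exists_isGreedyOutput_supports M hv, fun w i S y => ?_, fun D _ hD => ?_⟩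
  · have : (0 : ℝ) ≤ b ^ 7 := by positivity
    linarith
  · rw [numQueries_sampleAlg]
    push_cast
    calc (N : ℝ) * ((c + 1) * (2 * c)) ≤ 3 * b ^ 5 * (b * (2 * b)) := by
          gcongr <;> linarith
      _ = 6 * b ^ 7 := by ring
  · rw [run_sampleAlg]; rfl
  · simp only [run_sampleAlg, ← residual_empty (M := M)]
    refine (measure_mono ?_).trans ((measure_samples_le (M := M) hD N (η := ε / 2)
      (by positivity)).trans (ENNReal.ofReal_le_ofReal (two_pow_mul_exp_le hδ
        (b := b) (by linarith) ?_)))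
    · intro w hw h
      refine hw fun σ X hX => le_trans ?_ (h σ X hX)
      change _ * ∫ v, residualOpt M v ∅ ∂(Measure.pi D) - ε ≤ _
      -- The loss `5 / 4 * (ε / 2)` is at most `ε`.
      linarith
    · have hbε : 1 ≤ b * ε := by
        have : 1 / ε * ε ≤ b * ε := by gcongr; linarith
        rwa [one_div_mul_cancel hε.ne'] at this
      rw [le_div_iff₀ (by positivity)]
      calc b * (n + 1) ^ 2 ≤ b * b ^ 2 := by gcongr; linarith
        _ ≤ b * b ^ 2 * (b * ε) ^ 2 := le_mul_of_one_le_right (by positivity) (one_le_pow₀ hbε)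
        _ = 2 * (2 * b ^ 5) * (ε / 2) ^ 2 := by ring
        _ ≤ 2 * N * (ε / 2) ^ 2 := by gcongr
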